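/- For $n \ge 2$ let $\mathfrak{m}_0(n)$ be the Lie algebra over the field $\mathbb{F}_2$ with basis $e_1, \dots, e_n$ and brackets $[e_1, e_i] = e_{i+1}$ for $1 < i < n$, all other brackets $[e_i,e_j]$ with $i<j$ being zero. Let $b_q(\mathfrak{m}_0(n)) = \dim H^q(\mathfrak{m}_0(n))$ be its $q$-th Betti number, where $H^q(\mathfrak g) = \ker(d : \Lambda^q \mathfrak g^* \to \Lambda^{q+1} \mathfrak g^*) / \operatorname{Im}(d : \Lambda^{q-1} \mathfrak g^* \to \Lambda^{q} \mathfrak g^*)$ is the cohomology with trivial coefficients $\mathbb{F}_2$, and $d$ is the derivation of the exterior algebra $\Lambda \mathfrak g^*$ with $d\xi(X,Y) = \xi([X,Y])$ for $\xi \in \mathfrak g^*$ and $X, Y \in \mathfrak g$. Then (a) $b_1(\mathfrak{m}_0(n)) = 2$; (b) $b_2(\mathfrak{m}_0(n)) = \lfloor \frac{n+1}{2} \rfloor$; (c) $b_3(\mathfrak{m}_0(n)) = \frac13 (2^p-1)(2^{p-1}-1) + \frac12 m(m-1) + \lfloor \frac{n-1}{2} \rfloor$, where $n = 2^p + m$ with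 integers $p \ge 0$ and $0 < m \le 2^p$. -/

import Mathlib

noncomputable section

namespace LieCoh

/-! ### Cohomology of a finite-dimensional Lie algebra over `𝔽₂` with trivial coefficients -/

section General

variable {ι 𝔤 : Type*} [Fintype ι] [LinearOrder ι] [LieRing 𝔤] [LieAlgebra (ZMod 2) 𝔤]

/-- The algebra `Λ(𝔤*)` of exterior forms on `𝔤`. -/
abbrev Forms (𝔤 : Type*) [LieRing 𝔤] [LieAlgebra (ZMod 2) 𝔤] : Type _ :=
  ExteriorAlgebra (ZMod 2) (Module.Dual (ZMod 2) 𝔤)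

/-- The space `Λ^q(𝔤*)` of `q`-forms on `𝔤`, as a subspace of the algebra of forms. -/
abbrev qForms (𝔤 : Type*) [LieRing 𝔤] [LieAlgebra (ZMod 2) 𝔤] (q : ℕ) :
    Submodule (ZMod 2) (Forms 𝔤) :=
  ⋀[ZMod 2]^q (Module.Dual (ZMod 2) 𝔤)

/-- The differential of a one-form: `dξ` is the two-form `(X, Y) ↦ ξ ⁅X, Y⁆`, that is,
`∑_{i < j} ξ ⁅b i, b j⁆ • (bⁱ ∧ bʲ)` in terms of a basis `b` of `𝔤` and its dual basis. -/
def dOne (b : Module.Basis ι (ZMod 2) 𝔤) :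
    Module.Dual (ZMod 2) 𝔤 →ₗ[ZMod 2] Forms 𝔤 where
  toFun ξ := ∑ i : ι, ∑ j : ι, if i < j then
    ξ ⁅b i, b j⁆ • (ExteriorAlgebra.ι (ZMod 2) (b.coord i) *
      ExteriorAlgebra.ι (ZMod 2) (b.coord j)) else 0
  map_add' ξ η := by
    simp only [← Finset.sum_add_distrib]
    refine Finset.sum_congr rfl fun i _ => Finset.sum_congr rfl fun j _ => ?_
    split_ifs <;> simp [add_smul]
  map_smul' c ξ := by
    simp only [Finset.smul_sum]
    refine Finset.sum_congr rfl fun i _ => Finset.sum_congr rfl fun j _ => ?_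
    split_ifs <;> simp [mul_smul]

lemma two_smul_forms (x : Forms 𝔤) : x + x = 0 := by
  have h : (2 : ZMod 2) • x = 0 := by
    rw [show (2 : ZMod 2) = 0 from rfl, zero_smul]
  rwa [two_smul] at h

lemma commute_ι_ι_mul_ι (ξ η ζ : Module.Dual (ZMod 2) 𝔤) :
    ExteriorAlgebra.ι (ZMod 2) ξ *
        (ExteriorAlgebra.ι (ZMod 2) η * ExteriorAlgebra.ι (ZMod 2) ζ) =
      (ExteriorAlgebra.ι (ZMod 2) η * ExteriorAlgebra.ι (ZMod 2) ζ) *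
        ExteriorAlgebra.ι (ZMod 2) ξ := by
  have h (x y : Module.Dual (ZMod 2) 𝔤) :
      ExteriorAlgebra.ι (ZMod 2) x * ExteriorAlgebra.ι (ZMod 2) y =
        -(ExteriorAlgebra.ι (ZMod 2) y * ExteriorAlgebra.ι (ZMod 2) x) :=
    eq_neg_of_add_eq_zero_left (ExteriorAlgebra.ι_add_mul_swap x y)
  rw [← mul_assoc, h ξ η, neg_mul, mul_assoc, h ξ ζ, mul_neg, neg_neg, mul_assoc]

lemma ι_mul_dOne (b : Module.Basis ι (ZMod 2) 𝔤) (ξ η : Module.Dual (ZMod 2) 𝔤) :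
    ExteriorAlgebra.ι (ZMod 2) ξ * dOne b η = dOne b η * ExteriorAlgebra.ι (ZMod 2) ξ := by
  simp only [dOne, LinearMap.coe_mk, AddHom.coe_mk, Finset.mul_sum, Finset.sum_mul]
  refine Finset.sum_congr rfl fun i _ => Finset.sum_congr rfl fun j _ => ?_
  split_ifs
  · rw [mul_smul_comm, smul_mul_assoc, commute_ι_ι_mul_ι]
  · simp

/-- The linear map `ξ ↦ ξ + ε dξ` from one-forms to the dual numbers over `Λ(𝔤*)`
(where `ε² = 0`). -/
def dualNumberOne (b : Module.Basis ι (ZMod 2) 𝔤) :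
    Module.Dual (ZMod 2) 𝔤 →ₗ[ZMod 2] TrivSqZeroExt (Forms 𝔤) (Forms 𝔤) where
  toFun ξ := TrivSqZeroExt.inl (ExteriorAlgebra.ι (ZMod 2) ξ) + TrivSqZeroExt.inr (dOne b ξ)
  map_add' ξ η := by ext <;> simp
  map_smul' c ξ := by ext <;> simp

/-- The algebra homomorphism `ω ↦ ω + ε dω` from `Λ(𝔤*)` to the dual numbers over `Λ(𝔤*)`,
determined by `ξ ↦ ξ + ε dξ` on one-forms. -/
def dualNumberLift (b : Module.Basis ι (ZMod 2) 𝔤) :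
    Forms 𝔤 →ₐ[ZMod 2] TrivSqZeroExt (Forms 𝔤) (Forms 𝔤) :=
  ExteriorAlgebra.lift (ZMod 2) ⟨dualNumberOne b, fun ξ => by
    ext
    · simp [dualNumberOne]
    · simp [dualNumberOne, ι_mul_dOne, two_smul_forms]⟩

/-- The differential `d` on `Λ(𝔤*)`: the derivation extending `dOne`
(see `differential_ι` and `differential_mul`). -/
def differential (b : Module.Basis ι (ZMod 2) 𝔤) : Forms 𝔤 →ₗ[ZMod 2] Forms 𝔤 where
  toFun ω := (dualNumberLift b ω).snd
  map_add' ω η := by simp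
  map_smul' c ω := by simp

lemma dualNumberLift_fst (b : Module.Basis ι (ZMod 2) 𝔤) (ω : Forms 𝔤) :
    (dualNumberLift b ω).fst = ω := by
  have h : (TrivSqZeroExt.fstHom (ZMod 2) (Forms 𝔤) (Forms 𝔤)).comp (dualNumberLift b) =
      AlgHom.id (ZMod 2) (Forms 𝔤) := by
    ext ξ
    simp [dualNumberLift, dualNumberOne]
  exact DFunLike.congr_fun h ω

lemma differential_ι (b : Module.Basis ι (ZMod 2) 𝔤) (ξ : Module.Dual (ZMod 2) 𝔤) :
    differential b (ExteriorAlgebra.ι (ZMod 2) ξ) = dOne b ξ := by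
  simp [differential, dualNumberLift, dualNumberOne]

lemma differential_mul (b : Module.Basis ι (ZMod 2) 𝔤) (ω η : Forms 𝔤) :
    differential b (ω * η) = differential b ω * η + ω * differential b η := by
  simp [differential, dualNumberLift_fst, add_comm]

/-- The value of a two-form at `(X, Y)`. -/
def evalTwo (X Y : 𝔤) : Forms 𝔤 →ₗ[ZMod 2] Forms 𝔤 :=
  CliffordAlgebra.contractLeft (Q := 0) (Module.Dual.eval (ZMod 2) 𝔤 Y) ∘ₗ
    CliffordAlgebra.contractLeft (Q := 0) (Module.Dual.eval (ZMod 2) 𝔤 X)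

/-- The one-form differential is characterised by `dξ(X, Y) = ξ ⁅X, Y⁆`; in particular it does
not depend on the basis. -/
lemma evalTwo_dOne (b : Module.Basis ι (ZMod 2) 𝔤) (ξ : Module.Dual (ZMod 2) 𝔤) (X Y : 𝔤) :
    evalTwo X Y (dOne b ξ) = algebraMap (ZMod 2) _ (ξ ⁅X, Y⁆) := by
  have key (α β : Module.Dual (ZMod 2) 𝔤) :
      evalTwo X Y (ExteriorAlgebra.ι (ZMod 2) α * ExteriorAlgebra.ι (ZMod 2) β) =
        algebraMap (ZMod 2) _ (α X * β Y - β X * α Y) := by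
    rw [evalTwo, LinearMap.comp_apply, ExteriorAlgebra.ι, CliffordAlgebra.contractLeft_ι_mul,
      CliffordAlgebra.contractLeft_ι, map_sub, map_smul, CliffordAlgebra.contractLeft_ι,
      CliffordAlgebra.contractLeft_mul_algebraMap, CliffordAlgebra.contractLeft_ι,
      ← map_mul, Algebra.smul_def, ← map_mul, ← map_sub]
    simp only [Module.Dual.eval_apply]
    rw [mul_comm (β X)]
  have expand : ξ ⁅X, Y⁆ =
      ∑ i, ∑ j, (b.coord i X * b.coord j Y) * ξ ⁅b i, b j⁆ := by
    conv_lhs => rw [← b.sum_repr X, ← b.sum_repr Y]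
    simp only [sum_lie, lie_sum, smul_lie, lie_smul, map_sum, map_smul,
      smul_eq_mul, Module.Basis.coord_apply, Finset.mul_sum]
    rw [Finset.sum_comm]
    refine Finset.sum_congr rfl fun i _ => Finset.sum_congr rfl fun j _ => ?_
    ring
  have split : ∑ i, ∑ j, (b.coord i X * b.coord j Y) * ξ ⁅b i, b j⁆ =
      ∑ i, ∑ j, ((if i < j then (b.coord i X * b.coord j Y) * ξ ⁅b i, b j⁆ else 0) +
        (if j < i then (b.coord i X * b.coord j Y) * ξ ⁅b i, b j⁆ else 0)) := by
    refine Finset.sum_congr rfl fun i _ => Finset.sum_congr rfl fun j _ => ?_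
    rcases lt_trichotomy i j with h | h | h
    · simp [h, h.not_gt]
    · simp [h]
    · simp [h, h.not_gt]
  have swap : ∑ i, ∑ j, (if j < i then (b.coord i X * b.coord j Y) * ξ ⁅b i, b j⁆ else 0) =
      ∑ i, ∑ j, (if i < j then (b.coord j X * b.coord i Y) * ξ ⁅b j, b i⁆ else 0) :=
    Finset.sum_comm
  rw [expand, split]
  simp only [Finset.sum_add_distrib]
  rw [swap]
  simp only [← Finset.sum_add_distrib, dOne, LinearMap.coe_mk, AddHom.coe_mk, map_sum]
  refine Finset.sum_congr rfl fun i _ => Finset.sum_congr rfl fun j _ => ?_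
  split_ifs
  · rw [map_smul, key, Algebra.smul_def, ← map_mul, ← lie_skew (b i) (b j), map_neg]
    congr 1
    ring
  · simp

/-- The `q`-cocycles: the kernel of `d : Λ^q → Λ^(q+1)`. -/
def cocycles (b : Module.Basis ι (ZMod 2) 𝔤) (q : ℕ) : Submodule (ZMod 2) (Forms 𝔤) :=
  qForms 𝔤 q ⊓ LinearMap.ker (differential b)

/-- The `q`-coboundaries: the image of `d : Λ^(q-1) → Λ^q`, which is zero for `q = 0`. -/
def coboundaries (b : Module.Basis ι (ZMod 2) 𝔤) : ℕ → Submodule (ZMod 2) (Forms 𝔤)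
  | 0 => ⊥
  | q + 1 => (qForms 𝔤 q).map (differential b)

/-- The `q`-th cohomology space `H^q(𝔤)` with trivial coefficients. -/
abbrev Cohomology (b : Module.Basis ι (ZMod 2) 𝔤) (q : ℕ) : Type _ :=
  cocycles b q ⧸ (coboundaries b q).submoduleOf (cocycles b q)

/-- The `q`-th Betti number `b_q(𝔤) = dim H^q(𝔤)`. -/
def betti (b : Module.Basis ι (ZMod 2) 𝔤) (q : ℕ) : ℕ :=
  Module.finrank (ZMod 2) (Cohomology b q)

end General

/-! ### The Lie algebra `𝔪₀(n)` over `𝔽₂` -/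

/-- The underlying space of `𝔪₀(n)`. The basis vector `e_i` (`1 ≤ i ≤ n`) of the usual numbering
has index `i - 1` in `Fin n`. -/
def M0 (n : ℕ) : Type := Fin n → ZMod 2

namespace M0

variable {n : ℕ}

instance : AddCommGroup (M0 n) := inferInstanceAs (AddCommGroup (Fin n → ZMod 2))

instance : Module (ZMod 2) (M0 n) := inferInstanceAs (Module (ZMod 2) (Fin n → ZMod 2))

/-- The coordinates of a vector of `𝔪₀(n)`. -/
def coords (n : ℕ) : M0 n ≃ₗ[ZMod 2] (Fin n → ZMod 2) where
  toFun x := x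
  invFun x := x
  map_add' _ _ := rfl
  map_smul' _ _ := rfl

/-- The basis `e_1, …, e_n` of `𝔪₀(n)`. -/
def basis (n : ℕ) : Module.Basis (Fin n) (ZMod 2) (M0 n) :=
  Module.Basis.ofEquivFun (coords n)

/-- The bracket of `𝔪₀(n)`: `[e_1, e_i] = e_{i+1}` for `1 < i < n`, the other brackets of basis
vectors being zero except for `[e_i, e_1] = -e_{i+1}`. In coordinates, counted from `0`, the
coordinate `k ≥ 2` of `[x, y]` is `x_0 y_{k-1} - y_0 x_{k-1}`, and the coordinates `0` and `1`
vanish. -/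
instance : Bracket (M0 n) (M0 n) where
  bracket x y := fun k : Fin n => if 2 ≤ k.1 then
    x ⟨0, k.pos⟩ * y ⟨k.1 - 1, by have := k.isLt; omega⟩ -
      y ⟨0, k.pos⟩ * x ⟨k.1 - 1, by have := k.isLt; omega⟩ else 0

lemma bracket_apply (x y : M0 n) (k : Fin n) : ⁅x, y⁆ k = if 2 ≤ k.1 then
    x ⟨0, k.pos⟩ * y ⟨k.1 - 1, by have := k.isLt; omega⟩ -
      y ⟨0, k.pos⟩ * x ⟨k.1 - 1, by have := k.isLt; omega⟩
    else 0 := rfl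

lemma add_apply' (x y : M0 n) (k : Fin n) : (x + y) k = x k + y k := rfl

lemma smul_apply' (c : ZMod 2) (x : M0 n) (k : Fin n) : (c • x) k = c * x k := rfl

lemma bracket_apply_zero (x y : M0 n) (h : 0 < n) : ⁅x, y⁆ ⟨0, h⟩ = 0 := by
  simp [bracket_apply]

instance : LieRing (M0 n) where
  add_lie x y z := by
    funext k
    simp only [bracket_apply, add_apply']
    split_ifs <;> ring
  lie_add x y z := by
    funext k
    simp only [bracket_apply, add_apply']
    split_ifs <;> ring
  lie_self x := by
    funext k
    simp only [bracket_apply, sub_self, ite_self]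
    rfl
  leibniz_lie x y z := by
    funext k
    rw [add_apply']
    by_cases hk : 2 ≤ k.1
    · rw [bracket_apply x, bracket_apply ⁅x, y⁆, bracket_apply y ⁅x, z⁆]
      simp only [if_pos hk, bracket_apply_zero]
      by_cases hk' : 2 ≤ k.1 - 1
      · simp only [bracket_apply, if_pos hk']
        ring
      · simp only [bracket_apply, if_neg hk']
        ring
    · simp [bracket_apply, hk]

instance : LieAlgebra (ZMod 2) (M0 n) where
  lie_smul c x y := by
    funext k
    simp only [bracket_apply, smul_apply']
    split_ifs <;> ring

lemma basis_apply (i k : Fin n) : basis n i k = if k = i then 1 else 0 := by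
  rw [basis, Module.Basis.coe_ofEquivFun]
  exact Pi.single_apply i (1 : ZMod 2) k

/-- `[e_1, e_i] = e_{i+1}` for `1 < i < n`. -/
lemma lie_basis (i : ℕ) (hi : 1 ≤ i) (hn : i + 1 < n) :
    ⁅basis n ⟨0, by omega⟩, basis n ⟨i, by omega⟩⁆ = basis n ⟨i + 1, hn⟩ := by
  funext k
  simp only [bracket_apply, basis_apply, Fin.ext_iff]
  split_ifs <;> first | omega | simp

/-- `[e_1, e_n] = 0`. -/
lemma lie_basis_last (i : ℕ) (hn : i + 1 = n) :
    ⁅basis n ⟨0, by omega⟩, basis n ⟨i, by omega⟩⁆ = 0 := by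
  funext k
  change _ = (0 : ZMod 2)
  simp only [bracket_apply, basis_apply, Fin.ext_iff]
  split_ifs <;> first | omega | simp

/-- `[e_i, e_j] = 0` for `i, j > 1`. -/
lemma lie_basis_eq_zero (i j : Fin n) (hi : 1 ≤ i.1) (hj : 1 ≤ j.1) :
    ⁅basis n i, basis n j⁆ = 0 := by
  funext k
  change _ = (0 : ZMod 2)
  simp only [bracket_apply, basis_apply, Fin.ext_iff]
  split_ifs <;> first | omega | simp

end M0

end LieCoh

end

noncomputable section

open Module

namespace LieCoh

/-! ### Dimension counts for kernels and nilpotent operators -/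

section LinearAlgebra

variable {K V W : Type*} [Field K] [AddCommGroup V] [Module K V] [AddCommGroup W] [Module K W]

/-! Write `n = N + 1`. The vectors `e_2, …, e_n` span an abelian ideal, and `dω = e^1 ∧ Dω` for the
derivation `D` induced by the transpose of `ad e_1`. So a form is closed exactly when `D` kills its
restriction to the ideal, and `D` acts there as the shift derivation on alternating functions of
indices below `N`. With `K_q` the dimension of the kernel of `D` on `q`-forms on the ideal,
rank-nullity gives `b_q = K_q + K_(q-1)`. The problem reduces to `K_1 = 1`, `K_2 = N / 2`
(`finrank_ker2`) and `K_3` (`finrank_ker3`).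

The kernels for `q = 2, 3` are found by squeezing. Lower bound: in characteristic 2 the power `D ^ 2
^ t` is again a derivation, namely shift by `2 ^ t`, so it vanishes when `N = 2 ^ t`; hence the
kernel has dimension at least `(2 ^ t).choose q / 2 ^ t` (`finrank_le_mul_finrank_inf_ker`). Upper
bound: passing from `N` to `N + 1`, the kernel grows by a space of leading terms. For `q = 2` this
has dimension at most `N % 2`. For `q = 3` it is `Top N`, whose dimension rises by at most one per
step (`finrank_top_succ_le`) and drops to zero at `N = 2 ^ t - 1` (`top_two_pow_sub_one`). The upper
bounds sum to the lower bound at each power of two, so every increment is exact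
(`eq_sum_range_of_squeeze`). -/

lemma finrank_inf_ker_add_finrank_map (P : Submodule K V) [FiniteDimensional K P]
    (T : V →ₗ[K] W) :
    finrank K ↥(P ⊓ LinearMap.ker T) + finrank K (P.map T) = finrank K P := by
  have h := (T.domRestrict P).finrank_range_add_finrank_ker
  have h1 : LinearMap.range (T.domRestrict P) = P.map T := by
    ext x; simp
  have h2 : P ⊓ LinearMap.ker T =
      (LinearMap.ker (T.domRestrict P)).map P.subtype := by
    ext x; simp [and_comm]
  rw [h1] at h
  rw [h2, Submodule.finrank_map_subtype_eq, add_comm, h]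

/-- If `T ^ k` annihilates a `T`-stable space `P`, then `dim P ≤ k * dim (ker T|_P)`. -/
lemma finrank_le_mul_finrank_inf_ker (P : Submodule K V) [FiniteDimensional K P]
    (T : V →ₗ[K] V) (hT : ∀ x ∈ P, T x ∈ P) (k : ℕ) (hk : ∀ x ∈ P, (T ^ k) x = 0) :
    finrank K P ≤ k * finrank K ↥(P ⊓ LinearMap.ker T) := by
  have hpow (j : ℕ) : ∀ x ∈ P, (T ^ j) x ∈ P := by
    induction j with
    | zero => simp
    | succ j ih =>
      intro x hx
      rw [pow_succ', Module.End.mul_apply]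
      exact hT _ (ih x hx)
  have key (j : ℕ) : finrank K ↥(P ⊓ LinearMap.ker (T ^ j)) ≤
      j * finrank K ↥(P ⊓ LinearMap.ker T) := by
    induction j with
    | zero =>
      have : P ⊓ LinearMap.ker (T ^ 0) = ⊥ := by
        rw [eq_bot_iff]
        rintro x ⟨-, hx⟩
        simpa using hx
      rw [this]
      simp
    | succ j ih =>
      have : FiniteDimensional K ↥(P ⊓ LinearMap.ker (T ^ (j + 1))) :=
        Submodule.finiteDimensional_of_le (inf_le_left : _ ≤ P)
      have : FiniteDimensional K ↥(P ⊓ LinearMap.ker T) :=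
        Submodule.finiteDimensional_of_le (inf_le_left : _ ≤ P)
      -- `T ^ j` maps `P ∩ ker T ^ (j + 1)` into `P ∩ ker T`, with kernel `P ∩ ker T ^ j`, so each
      -- layer of the filtration adds at most `dim (P ∩ ker T)`.
      rw [← finrank_inf_ker_add_finrank_map (P ⊓ LinearMap.ker (T ^ (j + 1))) (T ^ j), add_mul,
        one_mul]
      refine add_le_add (le_of_eq_of_le ?_ ih) (Submodule.finrank_mono ?_)
      · refine congrArg (fun S : Submodule K V => finrank K S) (Submodule.ext fun x => ?_)
        simp only [Submodule.mem_inf, LinearMap.mem_ker, pow_succ', Module.End.mul_apply]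
        constructor
        · rintro ⟨⟨h1, -⟩, h2⟩
          exact ⟨h1, h2⟩
        · rintro ⟨h1, h2⟩
          exact ⟨⟨h1, by rw [h2, map_zero]⟩, h2⟩
      · rintro _ ⟨x, ⟨hx, hx'⟩, rfl⟩
        refine ⟨hpow j x hx, ?_⟩
        change T ((T ^ j) x) = 0
        rw [← Module.End.mul_apply, ← pow_succ']
        exact hx'
  have h : P ⊓ LinearMap.ker (T ^ k) = P := inf_eq_left.2 hk
  have hkey := key k
  rwa [h] at hkey

lemma finrank_le_one_of_forall (P : Submodule K V) (φ : V →ₗ[K] K)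
    (h : ∀ x ∈ P, φ x = 0 → x = 0) : finrank K P ≤ 1 := by
  have := LinearMap.finrank_le_finrank_of_injective (f := φ.domRestrict P) (by
    rw [← LinearMap.ker_eq_bot, LinearMap.ker_eq_bot']
    rintro ⟨x, hx⟩ h0
    exact Subtype.ext (h x hx h0))
  simpa using this

end LinearAlgebra

/-- A sequence with increments at most `c` that reaches the sum of the `c i` infinitely often
is the sequence of partial sums of `c`. -/
lemma eq_sum_range_of_squeeze (k c : ℕ → ℕ) (h0 : k 0 = 0) (hk : ∀ i, k (i + 1) ≤ k i + c i)
    (hlow : ∀ n, ∃ N, n ≤ N ∧ ∑ i ∈ Finset.range N, c i ≤ k N) (n : ℕ) :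
    k n = ∑ i ∈ Finset.range n, c i := by
  have hle (n : ℕ) : k n ≤ ∑ i ∈ Finset.range n, c i := by
    induction n with
    | zero => simp [h0]
    | succ n ih =>
      rw [Finset.sum_range_succ]
      exact (hk n).trans (by omega)
  obtain ⟨N, hN, hN'⟩ := hlow n
  refine le_antisymm (hle n) ?_
  -- The deficit `∑ c - k` never decreases; being at most zero at `N`, it is at most zero at `n`.
  have hstep (d : ℕ) : k (n + d) + ∑ i ∈ Finset.range n, c i ≤
      k n + ∑ i ∈ Finset.range (n + d), c i := by
    induction d with
    | zero => simp
    | succ d ih =>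
      have h1 := hk (n + d)
      have h2 := Finset.sum_range_succ c (n + d)
      rw [← add_assoc]
      omega
  have := hstep (N - n)
  rw [Nat.add_sub_cancel' hN] at this
  omega

/-! ### Alternating functions on `ℕ`, `ℕ × ℕ`, `ℕ × ℕ × ℕ` and the shift derivation -/

/-- Functions on `ℕ` supported below `N`. -/
def Alt1 (N : ℕ) : Submodule (ZMod 2) (ℕ → ZMod 2) where
  carrier := {h | ∀ a, N ≤ a → h a = 0}
  add_mem' hx hy a ha := by simp [hx a ha, hy a ha]
  zero_mem' _ _ := rfl
  smul_mem' c x hx a ha := by simp [hx a ha]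

/-- Alternating functions of two variables supported below `N`. -/
def Alt2 (N : ℕ) : Submodule (ZMod 2) (ℕ → ℕ → ZMod 2) where
  carrier := {f | (∀ a, f a a = 0) ∧ (∀ a b, f a b = f b a) ∧ ∀ a b, N ≤ a → f a b = 0}
  add_mem' := by
    rintro x y ⟨h1, h2, h3⟩ ⟨k1, k2, k3⟩
    refine ⟨fun a => ?_, fun a b => ?_, fun a b ha => ?_⟩
    · simp [h1, k1]
    · simp [h2 a b, k2 a b]
    · simp [h3 a b ha, k3 a b ha]
  zero_mem' := ⟨fun _ => rfl, fun _ _ => rfl, fun _ _ _ => rfl⟩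
  smul_mem' := by
    rintro c x ⟨h1, h2, h3⟩
    refine ⟨fun a => ?_, fun a b => ?_, fun a b ha => ?_⟩
    · simp [h1]
    · simp [h2 a b]
    · simp [h3 a b ha]

/-- Alternating functions of three variables supported below `N`. -/
def Alt3 (N : ℕ) : Submodule (ZMod 2) (ℕ → ℕ → ℕ → ZMod 2) where
  carrier := {z | (∀ a c, z a a c = 0) ∧ (∀ a b c, z a b c = z b a c) ∧
    (∀ a b c, z a b c = z a c b) ∧ ∀ a b c, N ≤ a → z a b c = 0}
  add_mem' := by
    rintro x y ⟨h1, h2, h3, h4⟩ ⟨k1, k2, k3, k4⟩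
    refine ⟨fun a c => ?_, fun a b c => ?_, fun a b c => ?_, fun a b c ha => ?_⟩
    · simp [h1, k1]
    · simp [h2 a b, k2 a b]
    · simp [h3 a b, k3 a b]
    · simp [h4 a b c ha, k4 a b c ha]
  zero_mem' := ⟨fun _ _ => rfl, fun _ _ _ => rfl, fun _ _ _ => rfl, fun _ _ _ _ => rfl⟩
  smul_mem' := by
    rintro c x ⟨h1, h2, h3, h4⟩
    refine ⟨fun a c => ?_, fun a b c => ?_, fun a b c => ?_, fun a b c ha => ?_⟩
    · simp [h1]
    · simp [h2 a b]
    · simp [h3 a b]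
    · simp [h4 a b c ha]

instance (N : ℕ) : FiniteDimensional (ZMod 2) (Alt1 N) := by
  let φ : (ℕ → ZMod 2) →ₗ[ZMod 2] (Fin N → ZMod 2) :=
    { toFun := fun h a => h a, map_add' := fun _ _ => rfl, map_smul' := fun _ _ => rfl }
  refine FiniteDimensional.of_injective (φ.domRestrict (Alt1 N)) ?_
  rw [← LinearMap.ker_eq_bot, LinearMap.ker_eq_bot']
  rintro ⟨h, hh⟩ h0
  refine Subtype.ext (funext fun a => ?_)
  rcases lt_or_ge a N with ha | ha
  · exact congrFun h0 ⟨a, ha⟩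
  · exact hh a ha

instance (N : ℕ) : FiniteDimensional (ZMod 2) (Alt2 N) := by
  let φ : (ℕ → ℕ → ZMod 2) →ₗ[ZMod 2] (Fin N → Fin N → ZMod 2) :=
    { toFun := fun h a b => h a b, map_add' := fun _ _ => rfl, map_smul' := fun _ _ => rfl }
  refine FiniteDimensional.of_injective (φ.domRestrict (Alt2 N)) ?_
  rw [← LinearMap.ker_eq_bot, LinearMap.ker_eq_bot']
  rintro ⟨f, h1, h2, h3⟩ h0
  refine Subtype.ext (funext fun a => funext fun b => ?_)
  rcases lt_or_ge a N with ha | ha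
  · rcases lt_or_ge b N with hb | hb
    · exact congrFun (congrFun h0 ⟨a, ha⟩) ⟨b, hb⟩
    · exact (h2 a b).trans (h3 b a hb)
  · exact h3 a b ha

instance (N : ℕ) : FiniteDimensional (ZMod 2) (Alt3 N) := by
  let φ : (ℕ → ℕ → ℕ → ZMod 2) →ₗ[ZMod 2] (Fin N → Fin N → Fin N → ZMod 2) :=
    { toFun := fun h a b c => h a b c, map_add' := fun _ _ => rfl, map_smul' := fun _ _ => rfl }
  refine FiniteDimensional.of_injective (φ.domRestrict (Alt3 N)) ?_
  rw [← LinearMap.ker_eq_bot, LinearMap.ker_eq_bot']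
  rintro ⟨z, h1, h2, h3, h4⟩ h0
  refine Subtype.ext (funext fun a => funext fun b => funext fun c => ?_)
  rcases lt_or_ge a N with ha | ha
  · rcases lt_or_ge b N with hb | hb
    · rcases lt_or_ge c N with hc | hc
      · exact congrFun (congrFun (congrFun h0 ⟨a, ha⟩) ⟨b, hb⟩) ⟨c, hc⟩
      · exact (h3 a b c).trans ((h2 a c b).trans (h4 c a b hc))
    · exact (h2 a b c).trans (h4 b a c hb)
  · exact h4 a b c ha

lemma zmod_two_eq_of_add_eq_zero {x y : ZMod 2} (h : x + y = 0) : x = y := by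
  rwa [← CharTwo.sub_eq_add, sub_eq_zero] at h

/-- The shift of a function of one variable. -/
def shift1 : (ℕ → ZMod 2) →ₗ[ZMod 2] (ℕ → ZMod 2) where
  toFun h a := h (a + 1)
  map_add' _ _ := rfl
  map_smul' _ _ := rfl

/-- The derivation induced by the shift on functions of two variables. -/
def shift2 : (ℕ → ℕ → ZMod 2) →ₗ[ZMod 2] (ℕ → ℕ → ZMod 2) where
  toFun f a b := f (a + 1) b + f a (b + 1)
  map_add' f g := by
    funext a b
    simp only [Pi.add_apply]
    ring
  map_smul' c f := by
    funext a b
    simp [mul_add]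

/-- The derivation induced by the shift on functions of three variables. -/
def shift3 : (ℕ → ℕ → ℕ → ZMod 2) →ₗ[ZMod 2] (ℕ → ℕ → ℕ → ZMod 2) where
  toFun z a b c := z (a + 1) b c + z a (b + 1) c + z a b (c + 1)
  map_add' f g := by
    funext a b c
    simp only [Pi.add_apply]
    ring
  map_smul' c f := by
    funext a b c
    simp [mul_add]

lemma shift2_apply (f : ℕ → ℕ → ZMod 2) (a b : ℕ) :
    shift2 f a b = f (a + 1) b + f a (b + 1) := rfl

lemma shift3_apply (z : ℕ → ℕ → ℕ → ZMod 2) (a b c : ℕ) :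
    shift3 z a b c = z (a + 1) b c + z a (b + 1) c + z a b (c + 1) := rfl

lemma shift1_mem (N : ℕ) (h : ℕ → ZMod 2) (hh : h ∈ Alt1 N) : shift1 h ∈ Alt1 N :=
  fun a ha => hh (a + 1) (by omega)

lemma shift2_mem (N : ℕ) (f : ℕ → ℕ → ZMod 2) (hf : f ∈ Alt2 N) : shift2 f ∈ Alt2 N := by
  obtain ⟨h1, h2, h3⟩ := hf
  refine ⟨fun a => ?_, fun a b => ?_, fun a b ha => ?_⟩ <;> simp only [shift2_apply]
  · rw [h2 (a + 1) a, CharTwo.add_self_eq_zero]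
  · rw [h2 (a + 1) b, h2 a (b + 1), add_comm]
  · rw [h3 _ _ ha, h3 _ _ (ha.trans (Nat.le_succ a)), add_zero]

lemma shift3_mem (N : ℕ) (z : ℕ → ℕ → ℕ → ZMod 2) (hz : z ∈ Alt3 N) : shift3 z ∈ Alt3 N := by
  obtain ⟨h1, h2, h3, h4⟩ := hz
  refine ⟨fun a c => ?_, fun a b c => ?_, fun a b c => ?_, fun a b c ha => ?_⟩ <;>
    simp only [shift3_apply]
  · rw [h2 (a + 1) a c, h1, CharTwo.add_self_eq_zero, add_zero]
  · rw [h2 (a + 1) b c, h2 a (b + 1) c, h2 a b (c + 1), add_comm (z b (a + 1) c)]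
  · rw [h3 (a + 1) b c, h3 a (b + 1) c, h3 a b (c + 1), add_right_comm]
  · rw [h4 _ _ _ ha, h4 _ _ _ ha, h4 _ _ _ (ha.trans (Nat.le_succ a)), add_zero, add_zero]

/-- Evaluation of the first variable at `N`. -/
def evalAt (X : Type*) [AddCommGroup X] [Module (ZMod 2) X] (N : ℕ) :
    (ℕ → X) →ₗ[ZMod 2] X := LinearMap.proj N

lemma alt1_inf_ker (N : ℕ) :
    Alt1 (N + 1) ⊓ LinearMap.ker (evalAt (ZMod 2) N) = Alt1 N := by
  ext h
  constructor
  · rintro ⟨h1, h2⟩ a ha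
    rcases ha.eq_or_lt with rfl | ha
    · exact h2
    · exact h1 a ha
  · intro h1
    exact ⟨fun a ha => h1 a (by omega), h1 N le_rfl⟩

lemma alt2_inf_ker (N : ℕ) :
    Alt2 (N + 1) ⊓ LinearMap.ker (evalAt (ℕ → ZMod 2) N) = Alt2 N := by
  ext h
  constructor
  · rintro ⟨⟨h1, h2, h3⟩, h4⟩
    refine ⟨h1, h2, fun a b ha => ?_⟩
    rcases ha.eq_or_lt with rfl | ha
    · exact congrFun h4 b
    · exact h3 a b ha
  · rintro ⟨h1, h2, h3⟩
    exact ⟨⟨h1, h2, fun a b ha => h3 a b (by omega)⟩, funext fun b => h3 N b le_rfl⟩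

lemma alt3_inf_ker (N : ℕ) :
    Alt3 (N + 1) ⊓ LinearMap.ker (evalAt (ℕ → ℕ → ZMod 2) N) = Alt3 N := by
  ext h
  constructor
  · rintro ⟨⟨h1, h2, h3, h4⟩, h5⟩
    refine ⟨h1, h2, h3, fun a b c ha => ?_⟩
    rcases ha.eq_or_lt with rfl | ha
    · exact congrFun (congrFun h5 b) c
    · exact h4 a b c ha
  · rintro ⟨h1, h2, h3, h4⟩
    exact ⟨⟨h1, h2, h3, fun a b c ha => h4 a b c (by omega)⟩,
      funext fun b => funext fun c => h4 N b c le_rfl⟩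

lemma map_evalAt_alt1 (N : ℕ) : (Alt1 (N + 1)).map (evalAt (ZMod 2) N) = ⊤ := by
  rw [eq_top_iff]
  rintro x -
  refine ⟨fun a => if a = N then x else 0, fun a ha => if_neg (by omega), if_pos rfl⟩

lemma map_evalAt_alt2 (N : ℕ) : (Alt2 (N + 1)).map (evalAt (ℕ → ZMod 2) N) = Alt1 N := by
  refine le_antisymm ?_ fun h hh => ?_
  · rintro _ ⟨f, ⟨h1, h2, h3⟩, rfl⟩ a ha
    change f N a = 0
    rcases ha.eq_or_lt with rfl | ha
    · exact h1 N
    · exact (h2 N a).trans (h3 a N ha)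
  · have hN : h N = 0 := hh N le_rfl
    -- The witness is the wedge of the indicator of `N` with `h`; the same construction serves in
    -- three variables.
    refine ⟨fun a b => if a = N then h b else if b = N then h a else 0,
      ⟨fun a => ?_, fun a b => ?_, fun a b ha => ?_⟩, funext fun b => if_pos rfl⟩
    · grind
    · grind
    · have := hh a (by omega)
      grind

lemma map_evalAt_alt3 (N : ℕ) : (Alt3 (N + 1)).map (evalAt (ℕ → ℕ → ZMod 2) N) = Alt2 N := by
  refine le_antisymm ?_ ?_
  · rintro _ ⟨z, ⟨h1, h2, h3, h4⟩, rfl⟩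
    refine ⟨fun a => ?_, fun a b => h3 N a b, fun a b ha => ?_⟩
    · change z N a a = 0
      rw [h2, h3, h1]
    · change z N a b = 0
      rcases ha.eq_or_lt with rfl | ha
      · exact h1 N b
      · exact (h2 N a b).trans (h4 a N b ha)
  · rintro f ⟨h1, h2, h3⟩
    have hN (b : ℕ) : f N b = 0 := h3 N b le_rfl
    have hN' (b : ℕ) : f b N = 0 := (h2 b N).trans (hN b)
    refine ⟨fun a b c => if a = N then f b c else if b = N then f a c else
      if c = N then f a b else 0,
      ⟨fun a c => ?_, fun a b c => ?_, fun a b c => ?_, fun a b c ha => ?_⟩,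
      funext fun b => funext fun c => if_pos rfl⟩
    · grind
    · grind
    · grind
    · have := h3 a b (by omega)
      have := h3 a c (by omega)
      grind

lemma alt1_zero : Alt1 0 = ⊥ := by
  rw [eq_bot_iff]
  intro h hh
  exact funext fun a => hh a (Nat.zero_le a)

lemma alt2_zero : Alt2 0 = ⊥ := by
  rw [eq_bot_iff]
  rintro f ⟨-, -, h⟩
  exact funext fun a => funext fun b => h a b (Nat.zero_le a)

lemma alt3_zero : Alt3 0 = ⊥ := by
  rw [eq_bot_iff]
  rintro f ⟨-, -, -, h⟩
  exact funext fun a => funext fun b => funext fun c => h a b c (Nat.zero_le a)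

lemma finrank_alt1 (N : ℕ) : finrank (ZMod 2) (Alt1 N) = N := by
  induction N with
  | zero => rw [alt1_zero]; simp
  | succ N ih =>
    rw [← finrank_inf_ker_add_finrank_map (Alt1 (N + 1)) (evalAt _ N), alt1_inf_ker,
      map_evalAt_alt1, ih]
    simp

/-- Pascal's rule: fixing one variable at the top index `N` has kernel `Alt2 N` and image `Alt1 N`.
-/
lemma finrank_alt2 (N : ℕ) : finrank (ZMod 2) (Alt2 N) = N.choose 2 := by
  induction N with
  | zero => rw [alt2_zero]; simp
  | succ N ih =>
    rw [← finrank_inf_ker_add_finrank_map (Alt2 (N + 1)) (evalAt _ N), alt2_inf_ker,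
      map_evalAt_alt2, ih, finrank_alt1, Nat.choose_succ_succ' N 1, Nat.choose_one_right,
      add_comm N (N.choose 2)]

lemma finrank_alt3 (N : ℕ) : finrank (ZMod 2) (Alt3 N) = N.choose 3 := by
  induction N with
  | zero => rw [alt3_zero]; simp
  | succ N ih =>
    rw [← finrank_inf_ker_add_finrank_map (Alt3 (N + 1)) (evalAt _ N), alt3_inf_ker,
      map_evalAt_alt3, ih, finrank_alt2, Nat.choose_succ_succ' N 2, add_comm (N.choose 2)]

/-! ### Kernels of the shift derivation and their leading terms -/

/-- The kernel of the shift derivation on alternating functions of two variables. -/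
def Ker2 (N : ℕ) : Submodule (ZMod 2) (ℕ → ℕ → ZMod 2) := Alt2 N ⊓ LinearMap.ker shift2

/-- The kernel of the shift derivation on alternating functions of three variables. -/
def Ker3 (N : ℕ) : Submodule (ZMod 2) (ℕ → ℕ → ℕ → ZMod 2) := Alt3 N ⊓ LinearMap.ker shift3

instance (N : ℕ) : FiniteDimensional (ZMod 2) (Ker2 N) :=
  Submodule.finiteDimensional_of_le (inf_le_left : _ ≤ Alt2 N)

instance (N : ℕ) : FiniteDimensional (ZMod 2) (Ker3 N) :=
  Submodule.finiteDimensional_of_le (inf_le_left : _ ≤ Alt3 N)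

lemma ker2_inf_ker (N : ℕ) :
    Ker2 (N + 1) ⊓ LinearMap.ker (evalAt (ℕ → ZMod 2) N) = Ker2 N := by
  rw [Ker2, inf_right_comm, alt2_inf_ker, Ker2]

lemma ker3_inf_ker (N : ℕ) :
    Ker3 (N + 1) ⊓ LinearMap.ker (evalAt (ℕ → ℕ → ZMod 2) N) = Ker3 N := by
  rw [Ker3, inf_right_comm, alt3_inf_ker, Ker3]

lemma Ker2.apply_succ {N : ℕ} {f : ℕ → ℕ → ZMod 2} (hf : f ∈ Ker2 N) (a b : ℕ) :
    f (a + 1) b = f a (b + 1) :=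
  zmod_two_eq_of_add_eq_zero (congrFun (congrFun (LinearMap.mem_ker.1 hf.2) a) b)

lemma Ker2.apply_add {N : ℕ} {f : ℕ → ℕ → ZMod 2} (hf : f ∈ Ker2 N) (i a b : ℕ) :
    f (a + i) b = f a (b + i) := by
  induction i generalizing b with
  | zero => rfl
  | succ i ih => rw [← add_assoc, Ker2.apply_succ hf, ih, add_right_comm, add_assoc]

/-- A kernel element is constant along antidiagonals, and an antidiagonal of even sum meets the
diagonal, where alternation gives zero. -/
lemma Ker2.apply_of_even {N : ℕ} {f : ℕ → ℕ → ZMod 2} (hf : f ∈ Ker2 N) (a b : ℕ)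
    (hab : Even (a + b)) : f a b = 0 := by
  obtain ⟨r, hr⟩ := hab
  rcases le_total a r with h | h
  · have := Ker2.apply_add hf (r - a) a r
    rw [show a + (r - a) = r by omega, show r + (r - a) = b by omega, hf.1.1] at this
    exact this.symm
  · have := Ker2.apply_add hf (a - r) r b
    rw [show r + (a - r) = a by omega, show b + (a - r) = r by omega, hf.1.1] at this
    exact this

/-- The leading term `f N ·` vanishes off `0`, because `f N (b + 1) = f (N + 1) b = 0`. It is thus
determined by `f N 0`, which is zero for even `N`. -/
lemma finrank_ker2_succ_le (N : ℕ) :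
    finrank (ZMod 2) (Ker2 (N + 1)) ≤ finrank (ZMod 2) (Ker2 N) + N % 2 := by
  rw [← finrank_inf_ker_add_finrank_map (Ker2 (N + 1)) (evalAt _ N), ker2_inf_ker]
  have hzero : ∀ h ∈ (Ker2 (N + 1)).map (evalAt (ℕ → ZMod 2) N), h 0 = 0 → h = 0 := by
    rintro _ ⟨f, hf, rfl⟩ h0
    funext b
    rcases Nat.eq_zero_or_pos b with rfl | hb
    · exact h0
    · change f N b = 0
      obtain ⟨b, rfl⟩ : ∃ c, b = c + 1 := ⟨b - 1, by omega⟩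
      rw [← Ker2.apply_succ hf]
      exact hf.1.2.2 _ _ le_rfl
  rcases Nat.even_or_odd N with h | h
  · rw [Nat.even_iff.1 h, add_zero]
    have : (Ker2 (N + 1)).map (evalAt (ℕ → ZMod 2) N) = ⊥ := by
      rw [eq_bot_iff]
      intro x hx
      refine hzero x hx ?_
      obtain ⟨f, hf, rfl⟩ := hx
      exact Ker2.apply_of_even hf N 0 h
    rw [this]
    simp
  · rw [Nat.odd_iff.1 h]
    exact add_le_add le_rfl (finrank_le_one_of_forall _ (evalAt (ZMod 2) 0) hzero)

/-- The leading terms of elements of `Ker3 (N + 1)` relative to `Ker3 N`. -/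
def Top (N : ℕ) : Submodule (ZMod 2) (ℕ → ℕ → ZMod 2) :=
  (Ker3 (N + 1)).map (evalAt (ℕ → ℕ → ZMod 2) N)

lemma finrank_ker3_succ (N : ℕ) :
    finrank (ZMod 2) (Ker3 (N + 1)) = finrank (ZMod 2) (Ker3 N) + finrank (ZMod 2) (Top N) := by
  rw [← finrank_inf_ker_add_finrank_map (Ker3 (N + 1)) (evalAt _ N), ker3_inf_ker, Top]

/-- In the kernel equation at `(N, a, b)`, the term with first index `N + 1` lies outside the
support. -/
lemma top_le_ker2 (N : ℕ) : Top N ≤ Ker2 N := by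
  rintro _ ⟨z, hz, rfl⟩
  refine ⟨(map_evalAt_alt3 N).le ⟨z, hz.1, rfl⟩, ?_⟩
  funext a b
  have h := congrFun (congrFun (congrFun (LinearMap.mem_ker.1 hz.2) N) a) b
  rw [shift3_apply, hz.1.2.2.2 (N + 1) a b le_rfl, zero_add] at h
  exact h

instance (N : ℕ) : FiniteDimensional (ZMod 2) (Top N) :=
  Submodule.finiteDimensional_of_le (top_le_ker2 N)

/-- The diagonal shift of a function of two variables. -/
def diagShift : (ℕ → ℕ → ZMod 2) →ₗ[ZMod 2] (ℕ → ℕ → ZMod 2) where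
  toFun f a b := f (a + 1) (b + 1)
  map_add' _ _ := rfl
  map_smul' _ _ := rfl

/-- Raising all indices by one commutes with the shift derivation and lowers the support bound by
one. -/
lemma map_diagShift_top_le (N : ℕ) : (Top (N + 1)).map diagShift ≤ Top N := by
  rintro _ ⟨_, ⟨z, ⟨⟨h1, h2, h3, h4⟩, h5⟩, rfl⟩, rfl⟩
  refine ⟨fun a b c => z (a + 1) (b + 1) (c + 1), ⟨⟨fun a c => h1 _ _, fun a b c => h2 _ _ _,
    fun a b c => h3 _ _ _, fun a b c ha => h4 _ _ _ (by omega)⟩, ?_⟩, rfl⟩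
  funext a b c
  exact congrFun (congrFun (congrFun (LinearMap.mem_ker.1 h5) (a + 1)) (b + 1)) (c + 1)

/-- An element of `Top (N + 1)` killed by the diagonal shift can be nonzero only where an index is
`0`. Constancy along antidiagonals then leaves the single free value `f 0 1`. -/
lemma finrank_top_succ_le (N : ℕ) :
    finrank (ZMod 2) (Top (N + 1)) ≤ finrank (ZMod 2) (Top N) + 1 := by
  rw [← finrank_inf_ker_add_finrank_map (Top (N + 1)) diagShift, add_comm]
  refine add_le_add (Submodule.finrank_mono (map_diagShift_top_le N))
    (finrank_le_one_of_forall _ (evalAt (ZMod 2) 1 ∘ₗ evalAt (ℕ → ZMod 2) 0) ?_)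
  rintro f ⟨hf, hd⟩ h01
  have hf := top_le_ker2 _ hf
  have hd (a b : ℕ) : f (a + 1) (b + 1) = 0 :=
    congrFun (congrFun (LinearMap.mem_ker.1 hd) a) b
  have h01 : f 0 1 = 0 := h01
  have h0 (b : ℕ) : f 0 b = 0 := by
    match b with
    | 0 => exact hf.1.1 0
    | 1 => exact h01
    | b + 2 => rw [← Ker2.apply_succ hf, hd]
  funext a b
  rw [← zero_add a, Ker2.apply_add hf, h0]
  rfl

/-! ### Powers of the shift derivation in characteristic 2 -/

lemma shift1_pow_apply (k : ℕ) (h : ℕ → ZMod 2) (a : ℕ) : (shift1 ^ k) h a = h (a + k) := by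
  induction k generalizing h with
  | zero => rfl
  | succ k ih =>
    rw [pow_succ, Module.End.mul_apply, ih]
    rfl

/-- Frobenius: squaring a sum of commuting shifts produces each cross term twice. -/
lemma shift2_pow_two_pow_apply (t : ℕ) (f : ℕ → ℕ → ZMod 2) (a b : ℕ) :
    (shift2 ^ 2 ^ t) f a b = f (a + 2 ^ t) b + f a (b + 2 ^ t) := by
  induction t generalizing f a b with
  | zero => rfl
  | succ t ih =>
    have h2 : (2 : ZMod 2) = 0 := rfl
    rw [pow_succ 2 t, mul_two, pow_add, Module.End.mul_apply, ih, ih, ih]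
    simp only [← add_assoc]
    linear_combination f (a + 2 ^ t) (b + 2 ^ t) * h2

lemma shift3_pow_two_pow_apply (t : ℕ) (z : ℕ → ℕ → ℕ → ZMod 2) (a b c : ℕ) :
    (shift3 ^ 2 ^ t) z a b c = z (a + 2 ^ t) b c + z a (b + 2 ^ t) c + z a b (c + 2 ^ t) := by
  induction t generalizing z a b c with
  | zero => rfl
  | succ t ih =>
    have h2 : (2 : ZMod 2) = 0 := rfl
    rw [pow_succ 2 t, mul_two, pow_add, Module.End.mul_apply, ih, ih, ih, ih]
    simp only [← add_assoc]
    linear_combination (z (a + 2 ^ t) (b + 2 ^ t) c + z (a + 2 ^ t) b (c + 2 ^ t) +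
      z a (b + 2 ^ t) (c + 2 ^ t)) * h2

/-- All binomial coefficients `(2 ^ t - 1).choose i` with `i < 2 ^ t` are odd. -/
lemma shift2_pow_two_pow_sub_one_apply (t : ℕ) (f : ℕ → ℕ → ZMod 2) (a b : ℕ) :
    (shift2 ^ (2 ^ t - 1)) f a b =
      ∑ i ∈ Finset.range (2 ^ t), f (a + i) (b + (2 ^ t - 1 - i)) := by
  induction t generalizing f a b with
  | zero => simp
  | succ t ih =>
    have hQ : 0 < 2 ^ t := by positivity
    rw [show 2 ^ (t + 1) - 1 = (2 ^ t - 1) + 2 ^ t by rw [pow_succ]; omega, pow_add,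
      Module.End.mul_apply, ih]
    simp only [shift2_pow_two_pow_apply]
    rw [Finset.sum_add_distrib, pow_succ, mul_two, Finset.sum_range_add, add_comm]
    refine congrArg₂ (· + ·) (Finset.sum_congr rfl fun i hi => ?_)
      (Finset.sum_congr rfl fun i hi => ?_)
    · have := Finset.mem_range.1 hi
      congr 1
      omega
    · have := Finset.mem_range.1 hi
      congr 1 <;> omega

/-- The kernel equation trades an increment of the last index for the shift derivation in the other
two, so `z` is determined by its slice at `0`. -/
lemma Ker3.apply_eq_shift2_pow {N : ℕ} {z : ℕ → ℕ → ℕ → ZMod 2} (hz : z ∈ Ker3 N)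
    (a b c : ℕ) : z a b c = (shift2 ^ c) (fun a b => z a b 0) a b := by
  induction c generalizing a b with
  | zero => rfl
  | succ c ih =>
    rw [pow_succ', Module.End.mul_apply, shift2_apply, ← ih, ← ih]
    have h := congrFun (congrFun (congrFun (LinearMap.mem_ker.1 hz.2) a) b) c
    exact (zmod_two_eq_of_add_eq_zero h).symm

/-- Moving the index `2 ^ t - 1` to the last place writes `z` as `shift2 ^ (2 ^ t - 1)` of its slice
at `0`. All binomial coefficients being odd, this is a full antidiagonal sum, which cancels by
symmetry. -/
lemma top_two_pow_sub_one (t : ℕ) : Top (2 ^ t - 1) = ⊥ := by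
  rw [eq_bot_iff]
  intro h hh
  have hQ : 0 < 2 ^ t := by positivity
  have hker := top_le_ker2 _ hh
  obtain ⟨z, hz, rfl⟩ := hh
  rw [Nat.sub_add_cancel hQ] at hz
  obtain ⟨h1, h2, h3, h4⟩ := hz.1
  have key (s : ℕ) : z (2 ^ t - 1) 0 s = 0 := by
    rw [h2, h3, Ker3.apply_eq_shift2_pow hz, shift2_pow_two_pow_sub_one_apply]
    have hvan (i : ℕ) (hi : i < s) (hi' : i < 2 ^ t) :
        z (0 + i) (s + (2 ^ t - 1 - i)) 0 = 0 := by
      rw [h2]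
      exact h4 _ _ _ (by omega)
    -- Terms with `i < s` are already zero and stay fixed. On `s ≤ i < 2 ^ t` the reflection swaps
    -- the first two arguments of `z`; equal terms cancel, and a fixed point is on the diagonal.
    refine Finset.sum_involution
      (fun i _ => if s ≤ i then s + (2 ^ t - 1 - i) else i) ?_ ?_ ?_ ?_
    · intro i hi
      have hi := Finset.mem_range.1 hi
      split_ifs with hs
      · rw [h2 (0 + (s + (2 ^ t - 1 - i))),
          show s + (2 ^ t - 1 - (s + (2 ^ t - 1 - i))) = 0 + i by omega, zero_add (s + _),
          CharTwo.add_self_eq_zero]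
      · rw [hvan i (by omega) hi, add_zero]
    · intro i hi hne
      have hi := Finset.mem_range.1 hi
      split_ifs with hs
      · intro heq
        apply hne
        rw [heq, zero_add, h1]
      · exact absurd (hvan i (by omega) hi) hne
    · intro i hi
      have hi := Finset.mem_range.1 hi
      rw [Finset.mem_range]
      split_ifs <;> omega
    · intro i hi
      have hi := Finset.mem_range.1 hi
      split_ifs <;> omega
  funext a b
  -- Constancy along antidiagonals reduces every value to one with first index `0`.
  rw [← zero_add a, Ker2.apply_add hker]
  exact key (b + a)

/-! ### The squeeze: dimensions of the kernels -/

lemma log_add_two (N : ℕ) (h : N + 2 ≠ 2 ^ Nat.log 2 (N + 2)) :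
    Nat.log 2 (N + 2) = Nat.log 2 (N + 1) := by
  have h1 : 2 ^ Nat.log 2 (N + 2) ≤ N + 2 := Nat.pow_log_le_self 2 (by omega)
  refine le_antisymm (Nat.le_log_of_pow_le (by norm_num) (by omega))
    (Nat.log_mono_right (by omega))

/-- The bound is the distance from `N + 1` down to the nearest power of two: zero at each power,
where `Top` vanishes, and growing by one in between. -/
lemma finrank_top_le (N : ℕ) :
    finrank (ZMod 2) (Top N) ≤ N + 1 - 2 ^ Nat.log 2 (N + 1) := by
  induction N with
  | zero =>
    have := top_two_pow_sub_one 0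
    simp only [pow_zero, Nat.sub_self] at this
    rw [this]
    simp
  | succ N ih =>
    by_cases h : N + 2 = 2 ^ Nat.log 2 (N + 2)
    · have h1 := top_two_pow_sub_one (Nat.log 2 (N + 2))
      rw [← h] at h1
      have h2 : Top (N + 1) = ⊥ := h1
      rw [h2]
      simp
    · have h1 := finrank_top_succ_le N
      rw [show N + 1 + 1 = N + 2 from rfl, log_add_two N h]
      have : 2 ^ Nat.log 2 (N + 1) ≤ N + 1 := Nat.pow_log_le_self 2 (by omega)
      omega

/-- On the dyadic block starting at `i + 1 = 2 ^ p` the summands are `0, 1, 2, …`. A full block (`m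
= 2 ^ p`) carries the formula from `p` to `p + 1`. -/
lemma sum_sub_two_pow_log (p m : ℕ) (hm : m ≤ 2 ^ p) :
    6 * ((∑ i ∈ Finset.range (2 ^ p - 1 + m), (i + 1 - 2 ^ Nat.log 2 (i + 1)) : ℕ) : ℤ) =
      (2 ^ p - 1) * (2 ^ p - 2) + 3 * m * (m - 1) := by
  have step (p : ℕ) (h0 : 6 * ((∑ i ∈ Finset.range (2 ^ p - 1),
      (i + 1 - 2 ^ Nat.log 2 (i + 1)) : ℕ) : ℤ) = (2 ^ p - 1) * (2 ^ p - 2)) (m : ℕ)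
      (hm : m ≤ 2 ^ p) :
      6 * ((∑ i ∈ Finset.range (2 ^ p - 1 + m), (i + 1 - 2 ^ Nat.log 2 (i + 1)) : ℕ) : ℤ) =
        (2 ^ p - 1) * (2 ^ p - 2) + 3 * m * (m - 1) := by
    induction m with
    | zero => rw [add_zero, h0]; simp
    | succ m ih =>
      have hQ : 0 < 2 ^ p := by positivity
      rw [← add_assoc, Finset.sum_range_succ, Nat.cast_add, mul_add, ih (by omega)]
      have hlog : Nat.log 2 (2 ^ p - 1 + m + 1) = p := by
        rw [Nat.log_eq_iff (by simp)]
        rw [pow_succ]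
        omega
      rw [hlog, show 2 ^ p - 1 + m + 1 - 2 ^ p = m by omega]
      push_cast
      ring
  refine step p ?_ m hm
  clear hm
  induction p with
  | zero => simp
  | succ p ih =>
    have hQ : 0 < 2 ^ p := by positivity
    have h := step p ih (2 ^ p) le_rfl
    rw [show 2 ^ p - 1 + 2 ^ p = 2 ^ (p + 1) - 1 by rw [pow_succ]; omega] at h
    rw [h]
    push_cast
    ring

theorem finrank_ker3 (N : ℕ) : finrank (ZMod 2) (Ker3 N) =
    ∑ i ∈ Finset.range N, (i + 1 - 2 ^ Nat.log 2 (i + 1)) := by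
  refine eq_sum_range_of_squeeze (fun N => finrank (ZMod 2) (Ker3 N)) _ ?_ (fun i => ?_)
    (fun n => ⟨2 ^ n, Nat.lt_two_pow_self.le, ?_⟩) N
  · have : Ker3 0 = ⊥ := by rw [Ker3, alt3_zero, bot_inf_eq]
    change finrank (ZMod 2) (Ker3 0) = 0
    rw [this]
    simp
  · exact (finrank_ker3_succ i).le.trans (Nat.add_le_add_left (finrank_top_le i) _)
  · have hQ : 0 < 2 ^ n := by positivity
    -- The `2 ^ n`-th power shifts one variable by `2 ^ n`, beyond the support.
    have h1 := finrank_le_mul_finrank_inf_ker (Alt3 (2 ^ n)) shift3 (shift3_mem _) (2 ^ n) (by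
      rintro z ⟨h1, h2, h3, h4⟩
      funext a b c
      rw [shift3_pow_two_pow_apply, h4 _ _ _ (Nat.le_add_left _ _), h2 a (b + _),
        h4 _ _ _ (Nat.le_add_left _ _), h3 a b, h2 a (c + _), h4 _ _ _ (Nat.le_add_left _ _)]
      rfl)
    rw [finrank_alt3] at h1
    -- Taking `m = 1` makes the range `2 ^ n`; the extra summand is zero.
    have h2 := sum_sub_two_pow_log n 1 Nat.one_le_two_pow
    rw [Nat.sub_add_cancel hQ] at h2
    have h3 : (6 : ℤ) * ((2 ^ n).choose 3 : ℕ) = 2 ^ n * ((2 ^ n - 1) * (2 ^ n - 2)) := by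
      have h := Nat.descFactorial_eq_factorial_mul_choose (2 ^ n) 3
      have h' := congrArg (fun x : ℕ => (x : ℤ)) h
      simp only [Nat.descFactorial, Nat.factorial, Nat.sub_zero] at h'
      rcases Nat.lt_or_ge (2 ^ n) 2 with hlt | hge
      · have h1 : 2 ^ n = 1 := by omega
        have h1' : (2 : ℤ) ^ n = 1 := by exact_mod_cast h1
        rw [h1, h1', Nat.choose_eq_zero_of_lt (by norm_num)]
        simp
      · push_cast [Nat.cast_sub hge, Nat.cast_sub hQ] at h'
        linear_combination -h'
    refine Nat.le_of_mul_le_mul_left ?_ hQ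
    refine le_trans (le_of_eq ?_) h1
    zify
    push_cast at h2 h3 ⊢
    linarith [congrArg (fun x : ℤ => 2 ^ n * x) h2]

theorem finrank_ker2 (N : ℕ) : finrank (ZMod 2) (Ker2 N) = N / 2 := by
  have hsum (N : ℕ) : ∑ i ∈ Finset.range N, i % 2 = N / 2 := by
    induction N with
    | zero => rfl
    | succ N ih => rw [Finset.sum_range_succ, ih]; omega
  rw [← hsum]
  refine eq_sum_range_of_squeeze (fun N => finrank (ZMod 2) (Ker2 N)) _ ?_
    finrank_ker2_succ_le (fun n => ⟨2 ^ n, Nat.lt_two_pow_self.le, ?_⟩) N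
  · have : Ker2 0 = ⊥ := by rw [Ker2, alt2_zero, bot_inf_eq]
    change finrank (ZMod 2) (Ker2 0) = 0
    rw [this]
    simp
  · have hQ : 0 < 2 ^ n := by positivity
    have h1 := finrank_le_mul_finrank_inf_ker (Alt2 (2 ^ n)) shift2 (shift2_mem _) (2 ^ n) (by
      rintro z ⟨h1, h2, h3⟩
      funext a b
      rw [shift2_pow_two_pow_apply, h3 _ _ (Nat.le_add_left _ _), h2 a (b + _),
        h3 _ _ (Nat.le_add_left _ _)]
      rfl)
    rw [finrank_alt2, Nat.choose_two_right] at h1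
    rw [hsum]
    have h2 : 2 ^ n * (2 ^ n - 1) / 2 * 2 = 2 ^ n * (2 ^ n - 1) :=
      Nat.div_mul_cancel (Nat.even_mul_pred_self _).two_dvd
    have h3 : 2 ^ n * (2 ^ n - 1) ≤ 2 ^ n * (finrank (ZMod 2) (Ker2 (2 ^ n)) * 2) := by
      rw [← h2, ← mul_assoc]
      exact Nat.mul_le_mul_right 2 h1
    have h4 := Nat.le_of_mul_le_mul_left h3 hQ
    -- Now twice the dimension is at least `2 ^ n - 1`, which is odd for `n > 0`, so the dimension
    -- is at least `2 ^ (n - 1)`.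
    rcases n with _ | n
    · simp
    · rw [pow_succ] at h4 ⊢
      omega

/-- The kernel of the shift on functions of one variable is spanned by the function supported
at `0`. -/
lemma finrank_alt1_inf_ker (N : ℕ) (hN : 0 < N) :
    finrank (ZMod 2) ↥(Alt1 N ⊓ LinearMap.ker shift1) = 1 := by
  refine le_antisymm (finrank_le_one_of_forall _ (evalAt (ZMod 2) 0) ?_) ?_
  · rintro h ⟨-, hh⟩ h0
    funext a
    rcases a with _ | a
    · exact h0
    · exact congrFun (LinearMap.mem_ker.1 hh) a
  · have h := finrank_le_mul_finrank_inf_ker (Alt1 N) shift1 (shift1_mem N) N (by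
      intro h hh
      funext a
      rw [shift1_pow_apply]
      exact hh _ (Nat.le_add_left _ _))
    rw [finrank_alt1] at h
    by_contra! h0
    rw [Nat.lt_one_iff.1 h0] at h
    omega

instance (𝔤 : Type*) [LieRing 𝔤] [LieAlgebra (ZMod 2) 𝔤] : CharP (Forms 𝔤) 2 :=
  charP_of_injective_algebraMap (ExteriorAlgebra.algebraMap_leftInverse _).injective 2

/-! ### Contractions detect forms of positive degree -/

section Contraction

variable {𝔤 : Type*} [LieRing 𝔤] [LieAlgebra (ZMod 2) 𝔤]

/-- Contraction of forms with a vector. -/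
def contr (X : 𝔤) : Forms 𝔤 →ₗ[ZMod 2] Forms 𝔤 :=
  CliffordAlgebra.contractLeft (Q := 0) (Module.Dual.eval (ZMod 2) 𝔤 X)

lemma contr_zero : contr (0 : 𝔤) = 0 := by
  rw [contr, map_zero, map_zero]

lemma contr_ι_mul (X : 𝔤) (ξ : Dual (ZMod 2) 𝔤) (ω : Forms 𝔤) :
    contr X (ExteriorAlgebra.ι (ZMod 2) ξ * ω) =
      ξ X • ω + ExteriorAlgebra.ι (ZMod 2) ξ * contr X ω := by
  rw [contr, ExteriorAlgebra.ι, CliffordAlgebra.contractLeft_ι_mul, CharTwo.sub_eq_add]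
  rfl

lemma contr_algebraMap (X : 𝔤) (r : ZMod 2) : contr X (algebraMap (ZMod 2) (Forms 𝔤) r) = 0 :=
  CliffordAlgebra.contractLeft_algebraMap _ _ r

lemma contr_contr_self (X : 𝔤) (ω : Forms 𝔤) : contr X (contr X ω) = 0 :=
  CliffordAlgebra.contractLeft_contractLeft _ _

lemma contr_comm (X Y : 𝔤) (ω : Forms 𝔤) : contr X (contr Y ω) = contr Y (contr X ω) := by
  rw [contr, contr, CliffordAlgebra.contractLeft_comm, CharTwo.neg_eq]

lemma ι_mul_ι_comm (ξ η : Dual (ZMod 2) 𝔤) :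
    ExteriorAlgebra.ι (ZMod 2) ξ * ExteriorAlgebra.ι (ZMod 2) η =
      ExteriorAlgebra.ι (ZMod 2) η * ExteriorAlgebra.ι (ZMod 2) ξ := by
  rw [eq_neg_of_add_eq_zero_left (ExteriorAlgebra.ι_add_mul_swap ξ η), CharTwo.neg_eq]

lemma exists_algebraMap_of_mem_qForms_zero {ω : Forms 𝔤} (h : ω ∈ qForms 𝔤 0) :
    ω = algebraMap (ZMod 2) _ (ExteriorAlgebra.algebraMapInv ω) := by
  rw [qForms, ExteriorAlgebra.exteriorPower, pow_zero, Submodule.mem_one] at h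
  obtain ⟨r, rfl⟩ := h
  rw [ExteriorAlgebra.algebraMap_leftInverse]

lemma ι_mul_mem_qForms {q : ℕ} {ω : Forms 𝔤} (ξ : Dual (ZMod 2) 𝔤) (h : ω ∈ qForms 𝔤 q) :
    ExteriorAlgebra.ι (ZMod 2) ξ * ω ∈ qForms 𝔤 (q + 1) := by
  rw [qForms, ExteriorAlgebra.exteriorPower, pow_succ']
  exact Submodule.mul_mem_mul (LinearMap.mem_range_self _ ξ) h

@[elab_as_elim]
lemma qForms_succ_induction {q : ℕ} {C : Forms 𝔤 → Prop}
    (hadd : ∀ x y, C x → C y → C (x + y))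
    (hmul : ∀ ξ : Dual (ZMod 2) 𝔤, ∀ ω ∈ qForms 𝔤 q, C (ExteriorAlgebra.ι (ZMod 2) ξ * ω))
    {ω : Forms 𝔤} (h : ω ∈ qForms 𝔤 (q + 1)) : C ω := by
  rw [qForms, ExteriorAlgebra.exteriorPower, pow_succ'] at h
  refine Submodule.mul_induction_on h ?_ hadd
  rintro _ ⟨ξ, rfl⟩ ω hω
  exact hmul ξ ω hω

lemma contr_mem_qForms (X : 𝔤) {q : ℕ} {ω : Forms 𝔤} (h : ω ∈ qForms 𝔤 (q + 1)) :
    contr X ω ∈ qForms 𝔤 q := by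
  induction q generalizing ω with
  | zero =>
    refine qForms_succ_induction (fun x y hx hy => ?_) (fun ξ ω hω => ?_) h
    · rw [map_add]
      exact add_mem hx hy
    · rw [contr_ι_mul, exists_algebraMap_of_mem_qForms_zero hω, contr_algebraMap, mul_zero,
        add_zero, ← exists_algebraMap_of_mem_qForms_zero hω]
      exact Submodule.smul_mem _ _ hω
  | succ q ih =>
    refine qForms_succ_induction (fun x y hx hy => ?_) (fun ξ ω hω => ?_) h
    · rw [map_add]
      exact add_mem hx hy
    · rw [contr_ι_mul]
      exact add_mem (Submodule.smul_mem _ _ hω) (ι_mul_mem_qForms ξ (ih hω))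

variable {ι : Type*}

/-- The projection of the dual space along a dual basis vector. -/
def dualProj (b : Basis ι (ZMod 2) 𝔤) (i : ι) : Dual (ZMod 2) 𝔤 →ₗ[ZMod 2] Dual (ZMod 2) 𝔤 :=
  LinearMap.id + (Dual.eval (ZMod 2) 𝔤 (b i)).smulRight (b.coord i)

lemma dualProj_apply (b : Basis ι (ZMod 2) 𝔤) (i : ι) (ξ : Dual (ZMod 2) 𝔤) :
    dualProj b i ξ = ξ + ξ (b i) • b.coord i := rfl

/-- The substitution `b^i ↦ 0` removes from `ω` the part divisible by `b^i`, which is `b^i ∧ contr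
(b i) ω`. -/
lemma map_dualProj (b : Basis ι (ZMod 2) 𝔤) (i : ι) (ω : Forms 𝔤) :
    ExteriorAlgebra.map (dualProj b i) ω =
      ω + ExteriorAlgebra.ι (ZMod 2) (b.coord i) * contr (b i) ω := by
  induction ω using CliffordAlgebra.left_induction with
  | algebraMap r =>
    rw [AlgHom.commutes, contr_algebraMap, mul_zero, add_zero]
  | add x y hx hy => rw [map_add, map_add, hx, hy, mul_add, add_add_add_comm]
  | ι_mul ω ξ ih =>
    change ExteriorAlgebra.map (dualProj b i) (ExteriorAlgebra.ι (ZMod 2) ξ * ω) =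
      ExteriorAlgebra.ι (ZMod 2) ξ * ω +
        ExteriorAlgebra.ι (ZMod 2) (b.coord i) * contr (b i) (ExteriorAlgebra.ι (ZMod 2) ξ * ω)
    have h : ExteriorAlgebra.ι (ZMod 2) (b.coord i) *
        (ExteriorAlgebra.ι (ZMod 2) (b.coord i) * contr (b i) ω) = 0 := by
      rw [← mul_assoc, ExteriorAlgebra.ι_sq_zero, zero_mul]
    rw [map_mul, ExteriorAlgebra.map_apply_ι, ih, contr_ι_mul, dualProj_apply, map_add, map_smul,
      mul_add, add_mul, add_mul, mul_add, smul_mul_assoc, smul_mul_assoc, h, smul_zero, add_zero,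
      mul_smul_comm, ← mul_assoc, ← mul_assoc, ι_mul_ι_comm ξ, add_assoc]

/-- A form of positive degree all of whose contractions vanish is zero. -/
lemma eq_zero_of_contr_eq_zero [Fintype ι] (b : Basis ι (ZMod 2) 𝔤) {q : ℕ} {ω : Forms 𝔤}
    (h : ω ∈ qForms 𝔤 (q + 1)) (hc : ∀ i, contr (b i) ω = 0) : ω = 0 := by
  classical
  -- Each substitution `b^i ↦ 0` fixes `ω`, since its contractions vanish. Performing all of them is
  -- the zero map on one-forms, which kills positive degree.
  have hfix (l : List ι) :
      ExteriorAlgebra.map ((l.map (dualProj b)).prod : Module.End (ZMod 2) (Dual (ZMod 2) 𝔤)) ω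
        = ω := by
    induction l with
    | nil => exact DFunLike.congr_fun ExteriorAlgebra.map_id ω
    | cons i l ih =>
      rw [List.map_cons, List.prod_cons, Module.End.mul_eq_comp, ← ExteriorAlgebra.map_comp_map,
        AlgHom.comp_apply, ih, map_dualProj, hc, mul_zero, add_zero]
  have heval (l : List ι) (ξ : Dual (ZMod 2) 𝔤) (j : ι) :
      ((l.map (dualProj b)).prod : Module.End (ZMod 2) (Dual (ZMod 2) 𝔤)) ξ (b j) =
        if j ∈ l then 0 else ξ (b j) := by
    induction l with
    | nil => simp
    | cons i l ih =>
      rw [List.map_cons, List.prod_cons, Module.End.mul_apply, dualProj_apply,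
        LinearMap.add_apply, LinearMap.smul_apply, Basis.coord_apply, Basis.repr_self,
        Finsupp.single_apply]
      by_cases hij : j = i
      · subst hij
        simp [CharTwo.add_self_eq_zero]
      · simp [ih, hij]
  have hzero : ((Finset.univ.toList.map (dualProj b)).prod :
      Module.End (ZMod 2) (Dual (ZMod 2) 𝔤)) = 0 := by
    ext1 ξ
    refine b.ext fun j => ?_
    rw [heval]
    simp
  rw [← hfix Finset.univ.toList, hzero]
  refine qForms_succ_induction (C := fun ω => ExteriorAlgebra.map
    (0 : Dual (ZMod 2) 𝔤 →ₗ[ZMod 2] Dual (ZMod 2) 𝔤) ω = 0) (fun x y hx hy => ?_)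
    (fun ξ ω _ => ?_) h
  · rw [map_add, hx, hy, add_zero]
  · rw [map_mul, ExteriorAlgebra.map_apply_ι, LinearMap.zero_apply, map_zero, zero_mul]

lemma finrank_qForms [Fintype ι] (b : Basis ι (ZMod 2) 𝔤) (q : ℕ) :
    finrank (ZMod 2) (qForms 𝔤 q) = (Fintype.card ι).choose q := by
  have : Module.Finite (ZMod 2) 𝔤 := Module.Finite.of_basis b
  rw [exteriorPower.finrank_eq, Subspace.dual_finrank_eq, finrank_eq_card_basis b]

lemma differential_algebraMap [Fintype ι] [LinearOrder ι] (b : Basis ι (ZMod 2) 𝔤) (r : ZMod 2) :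
    differential b (algebraMap (ZMod 2) (Forms 𝔤) r) = 0 := by
  simp [differential, TrivSqZeroExt.algebraMap_eq_inl']

end Contraction

/-! ### The complex of `𝔪₀(n)` -/

namespace M0

variable {N : ℕ}

/-- The vector with index `a`, which is zero for `n ≤ a`. -/
def vec (n a : ℕ) : M0 n := if h : a < n then basis n ⟨a, h⟩ else 0

lemma vec_fin {n : ℕ} (i : Fin n) : vec n i = basis n i := dif_pos i.2

lemma vec_of_le {n a : ℕ} (h : n ≤ a) : vec n a = 0 := dif_neg (by omega)

lemma lie_vec (a : ℕ) : ⁅vec (N + 1) 0, vec (N + 1) (a + 1)⁆ = vec (N + 1) (a + 2) := by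
  have h0 : vec (N + 1) 0 = basis (N + 1) ⟨0, by omega⟩ := dif_pos _
  rcases lt_trichotomy (a + 2) (N + 1) with h | h | h
  · rw [h0, vec, dif_pos (by omega), lie_basis (a + 1) (by omega) h, vec, dif_pos h]
  · rw [h0, vec, dif_pos (by omega), lie_basis_last (a + 1) h, vec_of_le h.ge]
  · rw [vec_of_le (by omega : N + 1 ≤ a + 1), lie_zero, vec_of_le (by omega)]

/-- The one-form dual to the first basis vector. -/
def cov (N : ℕ) : Dual (ZMod 2) (M0 (N + 1)) := (basis (N + 1)).coord 0

lemma cov_vec_zero : cov N (vec (N + 1) 0) = 1 := by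
  rw [cov, show vec (N + 1) 0 = basis (N + 1) 0 from vec_fin 0]
  simp

lemma cov_vec_succ (a : ℕ) : cov N (vec (N + 1) (a + 1)) = 0 := by
  rw [cov, vec]
  split_ifs with h
  · simp [Fin.ext_iff]
  · simp

/-- The transpose of the adjoint action of the first basis vector. -/
def coad (N : ℕ) (ξ : Dual (ZMod 2) (M0 (N + 1))) : Dual (ZMod 2) (M0 (N + 1)) :=
  ξ ∘ₗ LieAlgebra.ad (ZMod 2) (M0 (N + 1)) (vec (N + 1) 0)

lemma coad_apply (ξ : Dual (ZMod 2) (M0 (N + 1))) (X : M0 (N + 1)) :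
    coad N ξ X = ξ ⁅vec (N + 1) 0, X⁆ := rfl

lemma coad_cov : coad N (cov N) = 0 := by
  refine LinearMap.ext fun X => ?_
  rw [coad_apply]
  exact bracket_apply_zero (vec (N + 1) 0) X (Nat.succ_pos N)

end M0

namespace M0

variable {N : ℕ}

/-- Only brackets involving the first basis vector survive; this is the source of `d = e^1 ∧ D`. -/
lemma dOne_eq (ξ : Dual (ZMod 2) (M0 (N + 1))) : dOne (basis (N + 1)) ξ =
    ExteriorAlgebra.ι (ZMod 2) (cov N) * ExteriorAlgebra.ι (ZMod 2) (coad N ξ) := by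
  have h0 : vec (N + 1) 0 = basis (N + 1) 0 := vec_fin 0
  have hsum : coad N ξ = ∑ j, ξ ⁅basis (N + 1) 0, basis (N + 1) j⁆ • (basis (N + 1)).coord j := by
    rw [← Basis.sum_dual_apply_smul_coord (basis (N + 1)) (coad N ξ)]
    simp only [coad_apply, h0]
  rw [hsum, map_sum, Finset.mul_sum]
  change ∑ i : Fin (N + 1), ∑ j : Fin (N + 1), _ = _
  rw [Finset.sum_eq_single 0]
  · refine Finset.sum_congr rfl fun j _ => ?_
    rw [map_smul, mul_smul_comm]
    split_ifs with h
    · rfl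
    · have : j = 0 := le_antisymm (not_lt.1 h) (Fin.zero_le j)
      rw [this, lie_self, map_zero, zero_smul]
  · intro i _ hi
    have hi' : 0 < i := Fin.pos_iff_ne_zero.2 hi
    refine Finset.sum_eq_zero fun j _ => ?_
    split_ifs with h
    · rw [lie_basis_eq_zero i j hi' (lt_of_le_of_lt (Nat.zero_le _) h), map_zero, zero_smul]
    · rfl
  · simp

/-- The differential of `𝔪₀(n)`. -/
abbrev diff (N : ℕ) : Forms (M0 (N + 1)) →ₗ[ZMod 2] Forms (M0 (N + 1)) :=
  differential (basis (N + 1))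

/-- Multiplication by the one-form dual to the first basis vector. -/
def covMul (N : ℕ) : Forms (M0 (N + 1)) →ₗ[ZMod 2] Forms (M0 (N + 1)) :=
  LinearMap.mulLeft (ZMod 2) (ExteriorAlgebra.ι (ZMod 2) (cov N))

lemma covMul_apply (ω : Forms (M0 (N + 1))) :
    covMul N ω = ExteriorAlgebra.ι (ZMod 2) (cov N) * ω := rfl

lemma covMul_covMul (ω : Forms (M0 (N + 1))) : covMul N (covMul N ω) = 0 := by
  rw [covMul_apply, covMul_apply, ← mul_assoc, ExteriorAlgebra.ι_sq_zero, zero_mul]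

lemma ι_mul_covMul (ξ : Dual (ZMod 2) (M0 (N + 1))) (ω : Forms (M0 (N + 1))) :
    ExteriorAlgebra.ι (ZMod 2) ξ * covMul N ω = covMul N (ExteriorAlgebra.ι (ZMod 2) ξ * ω) := by
  rw [covMul_apply, covMul_apply, ← mul_assoc, ← mul_assoc, ι_mul_ι_comm]

lemma contr_zero_covMul (ω : Forms (M0 (N + 1))) :
    contr (vec (N + 1) 0) (covMul N ω) = ω + covMul N (contr (vec (N + 1) 0) ω) := by
  rw [covMul_apply, contr_ι_mul, cov_vec_zero, one_smul, covMul_apply]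

lemma contr_succ_covMul (a : ℕ) (ω : Forms (M0 (N + 1))) :
    contr (vec (N + 1) (a + 1)) (covMul N ω) = covMul N (contr (vec (N + 1) (a + 1)) ω) := by
  rw [covMul_apply, contr_ι_mul, cov_vec_succ, zero_smul, zero_add, covMul_apply]

lemma diff_ι_mul (ξ : Dual (ZMod 2) (M0 (N + 1))) (ω : Forms (M0 (N + 1))) :
    diff N (ExteriorAlgebra.ι (ZMod 2) ξ * ω) =
      covMul N (ExteriorAlgebra.ι (ZMod 2) (coad N ξ) * ω) +
        ExteriorAlgebra.ι (ZMod 2) ξ * diff N ω := by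
  rw [differential_mul, differential_ι, dOne_eq, mul_assoc, covMul_apply]

lemma covMul_diff (ω : Forms (M0 (N + 1))) : covMul N (diff N ω) = 0 := by
  induction ω using CliffordAlgebra.left_induction with
  | algebraMap r =>
    exact (congrArg (covMul N) (differential_algebraMap _ r)).trans (map_zero _)
  | add x y hx hy => rw [map_add, map_add, hx, hy, add_zero]
  | ι_mul ω ξ ih =>
    change covMul N (diff N (ExteriorAlgebra.ι (ZMod 2) ξ * ω)) = 0
    rw [diff_ι_mul, map_add, covMul_covMul, ← ι_mul_covMul, ih, mul_zero, add_zero]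

/-- Since `e^1 ∧ dω = 0`, contracting this product with `e_1` recovers `dω` as a multiple of `e^1`.
-/
lemma diff_eq_covMul (ω : Forms (M0 (N + 1))) :
    diff N ω = covMul N (contr (vec (N + 1) 0) (diff N ω)) := by
  have h := contr_zero_covMul (diff N ω)
  rw [covMul_diff, map_zero] at h
  exact CharTwo.add_eq_zero.1 h.symm

lemma diff_covMul (ω : Forms (M0 (N + 1))) : diff N (covMul N ω) = 0 := by
  rw [covMul_apply, diff_ι_mul, coad_cov, map_zero, zero_mul, map_zero, zero_add,
    ← covMul_apply, covMul_diff]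

lemma diff_diff (ω : Forms (M0 (N + 1))) : diff N (diff N ω) = 0 := by
  rw [diff_eq_covMul ω, diff_covMul]

lemma diff_mem_qForms {q : ℕ} {ω : Forms (M0 (N + 1))} (h : ω ∈ qForms (M0 (N + 1)) q) :
    diff N ω ∈ qForms (M0 (N + 1)) (q + 1) := by
  induction q generalizing ω with
  | zero =>
    rw [exists_algebraMap_of_mem_qForms_zero h, differential_algebraMap]
    exact zero_mem _
  | succ q ih =>
    refine qForms_succ_induction (fun x y hx hy => ?_) (fun ξ ω hω => ?_) h
    · rw [map_add]
      exact add_mem hx hy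
    · rw [diff_ι_mul]
      exact add_mem (ι_mul_mem_qForms _ (ι_mul_mem_qForms _ hω)) (ι_mul_mem_qForms ξ (ih hω))

/-- The Cartan formula for a basis vector other than the first. -/
lemma contr_diff (a : ℕ) (ω : Forms (M0 (N + 1))) :
    contr (vec (N + 1) (a + 1)) (diff N ω) =
      diff N (contr (vec (N + 1) (a + 1)) ω) + covMul N (contr (vec (N + 1) (a + 2)) ω) := by
  induction ω using CliffordAlgebra.left_induction with
  | algebraMap r =>
    have h1 : diff N (algebraMap (ZMod 2) _ r) = 0 := differential_algebraMap _ r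
    have h2 (X : M0 (N + 1)) := contr_algebraMap X r
    change contr _ (diff N (algebraMap (ZMod 2) (Forms (M0 (N + 1))) r)) =
      diff N (contr _ (algebraMap (ZMod 2) (Forms (M0 (N + 1))) r)) +
        covMul N (contr _ (algebraMap (ZMod 2) (Forms (M0 (N + 1))) r))
    rw [h1, h2, h2, map_zero, map_zero, map_zero, add_zero]
  | add x y hx hy =>
    simp only [map_add, hx, hy]
    abel
  | ι_mul ω ξ ih =>
    change contr (vec (N + 1) (a + 1)) (diff N (ExteriorAlgebra.ι (ZMod 2) ξ * ω)) =
      diff N (contr (vec (N + 1) (a + 1)) (ExteriorAlgebra.ι (ZMod 2) ξ * ω)) +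
        covMul N (contr (vec (N + 1) (a + 2)) (ExteriorAlgebra.ι (ZMod 2) ξ * ω))
    rw [diff_ι_mul, map_add, contr_succ_covMul]
    simp only [contr_ι_mul, map_add, map_smul, coad_apply, lie_vec, ih, diff_ι_mul, mul_add,
      ι_mul_covMul]
    abel

lemma algebraMap_eq_zero_of_covMul {r : ZMod 2}
    (h : covMul N (algebraMap (ZMod 2) _ r) = 0) : r = 0 := by
  have h1 := contr_zero_covMul (N := N) (algebraMap (ZMod 2) _ r)
  rw [h, contr_algebraMap, map_zero, map_zero, add_zero] at h1
  exact (ExteriorAlgebra.algebraMap_eq_zero_iff _ r).1 h1.symm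

/-! ### Coordinates of forms -/

/-- The values of (the degree one part of) a form at basis vectors. -/
def coord1 (n : ℕ) : Forms (M0 n) →ₗ[ZMod 2] (ℕ → ZMod 2) :=
  LinearMap.pi fun a => ExteriorAlgebra.algebraMapInv.toLinearMap ∘ₗ contr (vec n a)

/-- The values of (the degree two part of) a form at basis vectors. -/
def coord2 (n : ℕ) : Forms (M0 n) →ₗ[ZMod 2] (ℕ → ℕ → ZMod 2) :=
  LinearMap.pi fun a => coord1 n ∘ₗ contr (vec n a)

/-- The values of (the degree three part of) a form at basis vectors. -/
def coord3 (n : ℕ) : Forms (M0 n) →ₗ[ZMod 2] (ℕ → ℕ → ℕ → ZMod 2) :=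
  LinearMap.pi fun a => coord2 n ∘ₗ contr (vec n a)

lemma coord1_apply {n : ℕ} (ω : Forms (M0 n)) (a : ℕ) :
    coord1 n ω a = ExteriorAlgebra.algebraMapInv (contr (vec n a) ω) := rfl

lemma coord2_apply {n : ℕ} (ω : Forms (M0 n)) (a : ℕ) :
    coord2 n ω a = coord1 n (contr (vec n a) ω) := rfl

lemma coord3_apply {n : ℕ} (ω : Forms (M0 n)) (a : ℕ) :
    coord3 n ω a = coord2 n (contr (vec n a) ω) := rfl

lemma coord1_mem {n : ℕ} (ω : Forms (M0 n)) : coord1 n ω ∈ Alt1 n := fun a ha => by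
  rw [coord1_apply, vec_of_le ha, contr_zero, LinearMap.zero_apply, map_zero]

lemma coord2_mem {n : ℕ} (ω : Forms (M0 n)) : coord2 n ω ∈ Alt2 n := by
  refine ⟨fun a => ?_, fun a b => ?_, fun a b ha => ?_⟩
  · rw [coord2_apply, coord1_apply, contr_contr_self, map_zero]
  · rw [coord2_apply, coord1_apply, contr_comm, coord2_apply, coord1_apply]
  · rw [coord2_apply, vec_of_le ha, contr_zero, LinearMap.zero_apply, map_zero, Pi.zero_apply]

lemma coord3_mem {n : ℕ} (ω : Forms (M0 n)) : coord3 n ω ∈ Alt3 n := by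
  refine ⟨fun a c => ?_, fun a b c => ?_, fun a b c => ?_, fun a b c ha => ?_⟩
  · rw [coord3_apply, coord2_apply, contr_contr_self, map_zero, Pi.zero_apply]
  · rw [coord3_apply, coord2_apply, contr_comm, coord3_apply, coord2_apply]
  · exact (coord2_mem _).2.1 b c
  · rw [coord3_apply, vec_of_le ha, contr_zero, LinearMap.zero_apply, map_zero, Pi.zero_apply,
      Pi.zero_apply]

lemma eq_zero_of_contr_vec {n q : ℕ} {ω : Forms (M0 n)} (h : ω ∈ qForms (M0 n) (q + 1))
    (hc : ∀ a, contr (vec n a) ω = 0) : ω = 0 :=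
  eq_zero_of_contr_eq_zero (basis n) h fun i => by rw [← vec_fin, hc]

lemma eq_zero_of_coord1 {n : ℕ} {ω : Forms (M0 n)} (h : ω ∈ qForms (M0 n) 1)
    (h0 : coord1 n ω = 0) : ω = 0 := by
  refine eq_zero_of_contr_vec h fun a => ?_
  rw [exists_algebraMap_of_mem_qForms_zero (contr_mem_qForms (vec n a) h), ← coord1_apply, h0,
    Pi.zero_apply, map_zero]

lemma eq_zero_of_coord2 {n : ℕ} {ω : Forms (M0 n)} (h : ω ∈ qForms (M0 n) 2)
    (h0 : coord2 n ω = 0) : ω = 0 :=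
  eq_zero_of_contr_vec h fun a => eq_zero_of_coord1 (contr_mem_qForms _ h) (congrFun h0 a)

lemma eq_zero_of_coord3 {n : ℕ} {ω : Forms (M0 n)} (h : ω ∈ qForms (M0 n) 3)
    (h0 : coord3 n ω = 0) : ω = 0 :=
  eq_zero_of_contr_vec h fun a => eq_zero_of_coord2 (contr_mem_qForms _ h) (congrFun h0 a)

lemma finrank_qForms (n q : ℕ) : finrank (ZMod 2) (qForms (M0 n) q) = n.choose q := by
  rw [LieCoh.finrank_qForms (basis n), Fintype.card_fin]

instance (n q : ℕ) : FiniteDimensional (ZMod 2) (qForms (M0 n) q) := by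
  have : Module.Finite (ZMod 2) (M0 n) := Module.Finite.of_basis (basis n)
  infer_instance

/-- Surjectivity of coordinates comes from injectivity and equality of dimensions, with no preimage
constructed. -/
lemma map_qForms_eq {n q : ℕ} {Y : Type*} [AddCommGroup Y] [Module (ZMod 2) Y]
    (φ : Forms (M0 n) →ₗ[ZMod 2] Y) (A : Submodule (ZMod 2) Y) [FiniteDimensional (ZMod 2) A]
    (hA : finrank (ZMod 2) A = n.choose q) (hφ : ∀ ω, φ ω ∈ A)
    (hinj : ∀ ω ∈ qForms (M0 n) q, φ ω = 0 → ω = 0) : (qForms (M0 n) q).map φ = A := by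
  refine Submodule.eq_of_le_of_finrank_eq ?_ ?_
  · rintro _ ⟨ω, -, rfl⟩
    exact hφ ω
  · have h := finrank_inf_ker_add_finrank_map (qForms (M0 n) q) φ
    have h0 : qForms (M0 n) q ⊓ LinearMap.ker φ = ⊥ := by
      rw [eq_bot_iff]
      rintro ω ⟨h1, h2⟩
      exact hinj ω h1 h2
    rw [h0, finrank_bot, zero_add] at h
    rw [h, finrank_qForms, hA]

lemma map_coord1 (n : ℕ) : (qForms (M0 n) 1).map (coord1 n) = Alt1 n :=
  map_qForms_eq _ _ (by rw [finrank_alt1, Nat.choose_one_right]) coord1_mem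
    fun _ => eq_zero_of_coord1

lemma map_coord2 (n : ℕ) : (qForms (M0 n) 2).map (coord2 n) = Alt2 n :=
  map_qForms_eq _ _ (finrank_alt2 n) coord2_mem fun _ => eq_zero_of_coord2

lemma map_coord3 (n : ℕ) : (qForms (M0 n) 3).map (coord3 n) = Alt3 n :=
  map_qForms_eq _ _ (finrank_alt3 n) coord3_mem fun _ => eq_zero_of_coord3

/-- The diagonal shift of a function of three variables. -/
def tail3 : (ℕ → ℕ → ℕ → ZMod 2) →ₗ[ZMod 2] (ℕ → ℕ → ℕ → ZMod 2) where
  toFun z a b c := z (a + 1) (b + 1) (c + 1)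
  map_add' _ _ := rfl
  map_smul' _ _ := rfl

lemma map_shift1_alt1 (N : ℕ) : (Alt1 (N + 1)).map shift1 = Alt1 N := by
  refine le_antisymm ?_ fun h hh => ?_
  · rintro _ ⟨h, hh, rfl⟩ a ha
    exact hh (a + 1) (by omega)
  · refine ⟨fun a => if a = 0 then 0 else h (a - 1), fun a ha => ?_, funext fun a => rfl⟩
    change (if a = 0 then 0 else h (a - 1)) = 0
    rw [hh _ (by omega), ite_self]

lemma map_diagShift_alt2 (N : ℕ) : (Alt2 (N + 1)).map diagShift = Alt2 N := by
  refine le_antisymm ?_ ?_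
  · rintro _ ⟨f, ⟨h1, h2, h3⟩, rfl⟩
    exact ⟨fun a => h1 _, fun a b => h2 _ _, fun a b ha => h3 _ _ (by omega)⟩
  · rintro f ⟨h1, h2, h3⟩
    refine ⟨fun a b => if a = 0 ∨ b = 0 then 0 else f (a - 1) (b - 1),
      ⟨fun a => ?_, fun a b => ?_, fun a b ha => ?_⟩, ?_⟩
    · simp [h1]
    · simp only [h2 (a - 1), or_comm]
    · simp [h3 (a - 1) (b - 1) (by omega)]
    · funext a b
      exact if_neg (t := (0 : ZMod 2)) (by simp : ¬(a + 1 = 0 ∨ b + 1 = 0))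

lemma map_tail3_alt3 (N : ℕ) : (Alt3 (N + 1)).map tail3 = Alt3 N := by
  refine le_antisymm ?_ ?_
  · rintro _ ⟨f, ⟨h1, h2, h3, h4⟩, rfl⟩
    exact ⟨fun a c => h1 _ _, fun a b c => h2 _ _ _, fun a b c => h3 _ _ _,
      fun a b c ha => h4 _ _ _ (by omega)⟩
  · rintro f ⟨h1, h2, h3, h4⟩
    refine ⟨fun a b c => if a = 0 ∨ b = 0 ∨ c = 0 then 0 else f (a - 1) (b - 1) (c - 1),
      ⟨fun a c => ?_, fun a b c => ?_, fun a b c => ?_, fun a b c ha => ?_⟩, ?_⟩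
    · simp [h1]
    · simp only [h2 (a - 1), or_left_comm]
    · simp only [h3 (a - 1), or_comm]
    · simp [h4 (a - 1) (b - 1) (c - 1) (by omega)]
    · funext a b c
      exact if_neg (t := (0 : ZMod 2)) (by simp : ¬(a + 1 = 0 ∨ b + 1 = 0 ∨ c + 1 = 0))

/-! ### The differential as the shift derivation in coordinates -/

lemma contr_eq_algebraMap_coord1 {n : ℕ} {ω : Forms (M0 n)} (h : ω ∈ qForms (M0 n) 1) (a : ℕ) :
    contr (vec n a) ω = algebraMap (ZMod 2) _ (coord1 n ω a) :=
  exists_algebraMap_of_mem_qForms_zero (contr_mem_qForms _ h)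

/-- The two shifts play different roles: the inner one restricts to the ideal by dropping index `0`,
the outer one is the derivation. In degrees two and three `diagShift` and `tail3` do the
restricting. -/
lemma contr_diff1 {ω : Forms (M0 (N + 1))} (h : ω ∈ qForms (M0 (N + 1)) 1) (a : ℕ) :
    contr (vec (N + 1) (a + 1)) (diff N ω) =
      covMul N (algebraMap (ZMod 2) _ (shift1 (shift1 (coord1 (N + 1) ω)) a)) := by
  rw [contr_diff, contr_eq_algebraMap_coord1 h, contr_eq_algebraMap_coord1 h,
    differential_algebraMap, zero_add]
  rfl

lemma contr_contr_eq_algebraMap_coord2 {n : ℕ} {ω : Forms (M0 n)} (h : ω ∈ qForms (M0 n) 2)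
    (a b : ℕ) : contr (vec n b) (contr (vec n a) ω) = algebraMap (ZMod 2) _ (coord2 n ω a b) :=
  contr_eq_algebraMap_coord1 (contr_mem_qForms _ h) b

lemma contr_diff2 {ω : Forms (M0 (N + 1))} (h : ω ∈ qForms (M0 (N + 1)) 2) (a b : ℕ) :
    contr (vec (N + 1) (b + 1)) (contr (vec (N + 1) (a + 1)) (diff N ω)) =
      covMul N (algebraMap (ZMod 2) _ (shift2 (diagShift (coord2 (N + 1) ω)) a b)) := by
  rw [contr_diff, map_add, contr_diff1 (contr_mem_qForms _ h), contr_succ_covMul,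
    contr_contr_eq_algebraMap_coord2 h, ← map_add, ← map_add,
    add_comm (shift1 _ _)]
  rfl

lemma contr_diff3 {ω : Forms (M0 (N + 1))} (h : ω ∈ qForms (M0 (N + 1)) 3) (a b c : ℕ) :
    contr (vec (N + 1) (c + 1)) (contr (vec (N + 1) (b + 1)) (contr (vec (N + 1) (a + 1))
      (diff N ω))) =
      covMul N (algebraMap (ZMod 2) _ (shift3 (tail3 (coord3 (N + 1) ω)) a b c)) := by
  rw [contr_diff, map_add, map_add, contr_diff2 (contr_mem_qForms _ h), contr_succ_covMul,
    contr_succ_covMul, contr_contr_eq_algebraMap_coord2 (contr_mem_qForms _ h), ← map_add,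
    ← map_add, add_comm (shift2 _ _ _), shift3_apply, add_assoc]
  rfl

lemma contr_zero_diff_mem {q : ℕ} {ω : Forms (M0 (N + 1))} (h : ω ∈ qForms (M0 (N + 1)) q) :
    contr (vec (N + 1) 0) (diff N ω) ∈ qForms (M0 (N + 1)) q :=
  contr_mem_qForms _ (diff_mem_qForms h)

lemma diff_eq_zero_iff1 {ω : Forms (M0 (N + 1))} (h : ω ∈ qForms (M0 (N + 1)) 1) :
    diff N ω = 0 ↔ shift1 (shift1 (coord1 (N + 1) ω)) = 0 := by
  refine ⟨fun h0 => funext fun a => ?_, fun h0 => ?_⟩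
  · have h1 := contr_diff1 h a
    rw [h0, map_zero] at h1
    exact algebraMap_eq_zero_of_covMul h1.symm
  · have h1 : contr (vec (N + 1) 0) (diff N ω) = 0 := by
      refine eq_zero_of_coord1 (contr_zero_diff_mem h) (funext fun a => ?_)
      rcases a with _ | a
      · rw [coord1_apply, contr_contr_self, map_zero]
        rfl
      · rw [coord1_apply, contr_comm, contr_diff1 h, h0, Pi.zero_apply, map_zero, map_zero,
          map_zero, map_zero]
        rfl
    rw [diff_eq_covMul, h1, map_zero]

lemma diff_eq_zero_iff2 {ω : Forms (M0 (N + 1))} (h : ω ∈ qForms (M0 (N + 1)) 2) :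
    diff N ω = 0 ↔ shift2 (diagShift (coord2 (N + 1) ω)) = 0 := by
  refine ⟨fun h0 => funext fun a => funext fun b => ?_, fun h0 => ?_⟩
  · have h1 := contr_diff2 h a b
    rw [h0, map_zero, map_zero] at h1
    exact algebraMap_eq_zero_of_covMul h1.symm
  · have h1 : contr (vec (N + 1) 0) (diff N ω) = 0 := by
      refine eq_zero_of_coord2 (contr_zero_diff_mem h) (funext fun a => funext fun b => ?_)
      have hz (b : ℕ) : coord2 (N + 1) (contr (vec (N + 1) 0) (diff N ω)) 0 b = 0 := by
        rw [coord2_apply, contr_contr_self, map_zero]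
        rfl
      obtain ⟨-, h2, -⟩ := coord2_mem (contr (vec (N + 1) 0) (diff N ω))
      rcases a with _ | a
      · exact hz b
      rcases b with _ | b
      · exact (h2 _ _).trans (hz _)
      rw [coord2_apply, coord1_apply, contr_comm (vec (N + 1) (a + 1)),
        contr_comm (vec (N + 1) (b + 1)), contr_diff2 h, h0]
      simp only [Pi.zero_apply, map_zero]
    rw [diff_eq_covMul, h1, map_zero]

/-- As `dω` is a multiple of `e^1`, it suffices that its contraction with `e_1` vanish. Coordinates
of that contraction with an index `0` are zero automatically; the others are the shift derivation of
the restriction of `ω`. -/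
lemma diff_eq_zero_iff3 {ω : Forms (M0 (N + 1))} (h : ω ∈ qForms (M0 (N + 1)) 3) :
    diff N ω = 0 ↔ shift3 (tail3 (coord3 (N + 1) ω)) = 0 := by
  refine ⟨fun h0 => funext fun a => funext fun b => funext fun c => ?_, fun h0 => ?_⟩
  · have h1 := contr_diff3 h a b c
    rw [h0, map_zero, map_zero, map_zero] at h1
    exact algebraMap_eq_zero_of_covMul h1.symm
  · have h1 : contr (vec (N + 1) 0) (diff N ω) = 0 := by
      refine eq_zero_of_coord3 (contr_zero_diff_mem h)
        (funext fun a => funext fun b => funext fun c => ?_)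
      have hz (b c : ℕ) : coord3 (N + 1) (contr (vec (N + 1) 0) (diff N ω)) 0 b c = 0 := by
        rw [coord3_apply, contr_contr_self, map_zero]
        rfl
      obtain ⟨-, h2, h3, -⟩ := coord3_mem (contr (vec (N + 1) 0) (diff N ω))
      rcases a with _ | a
      · exact hz b c
      rcases b with _ | b
      · exact (h2 _ _ _).trans (hz _ _)
      rcases c with _ | c
      · exact (h3 _ _ _).trans ((h2 _ _ _).trans (hz _ _))
      rw [coord3_apply, coord2_apply, coord1_apply, contr_comm (vec (N + 1) (a + 1)),
        contr_comm (vec (N + 1) (b + 1)), contr_comm (vec (N + 1) (c + 1)), contr_diff3 h, h0]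
      simp only [Pi.zero_apply, map_zero]
    rw [diff_eq_covMul, h1, map_zero]

/-! ### Betti numbers -/

/-- Here `φ` is restriction to the ideal and `T` the derivation: `T ∘ φ` has the cocycles as kernel
and the same rank as `T` on `A`. -/
lemma finrank_cocycles_add {q : ℕ} {Y : Type*} [AddCommGroup Y] [Module (ZMod 2) Y]
    (φ : Forms (M0 (N + 1)) →ₗ[ZMod 2] Y) (T : Y →ₗ[ZMod 2] Y) (A : Submodule (ZMod 2) Y)
    [FiniteDimensional (ZMod 2) A] (hA : finrank (ZMod 2) A = N.choose q)
    (hφ : (qForms (M0 (N + 1)) q).map φ = A)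
    (hT : ∀ ω ∈ qForms (M0 (N + 1)) q, diff N ω = 0 ↔ T (φ ω) = 0) :
    finrank (ZMod 2) (cocycles (basis (N + 1)) q) + N.choose q =
      (N + 1).choose q + finrank (ZMod 2) ↥(A ⊓ LinearMap.ker T) := by
  have h1 := finrank_inf_ker_add_finrank_map (qForms (M0 (N + 1)) q) (T ∘ₗ φ)
  have h2 := finrank_inf_ker_add_finrank_map A T
  have h3 : qForms (M0 (N + 1)) q ⊓ LinearMap.ker (T ∘ₗ φ) = cocycles (basis (N + 1)) q := by
    ext ω
    exact and_congr_right fun h => (hT ω h).symm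
  rw [Submodule.map_comp, hφ, h3, finrank_qForms] at h1
  omega

lemma finrank_cocycles_zero : finrank (ZMod 2) (cocycles (basis (N + 1)) 0) = 1 := by
  have : cocycles (basis (N + 1)) 0 = qForms (M0 (N + 1)) 0 := by
    refine inf_eq_left.2 fun ω hω => ?_
    rw [LinearMap.mem_ker, exists_algebraMap_of_mem_qForms_zero hω, differential_algebraMap]
  rw [this, finrank_qForms, Nat.choose_zero_right]

lemma finrank_cocycles_one (hN : 0 < N) :
    finrank (ZMod 2) (cocycles (basis (N + 1)) 1) = 2 := by
  have h := finrank_cocycles_add (q := 1) (shift1 ∘ₗ coord1 (N + 1)) shift1 (Alt1 N)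
    (by rw [finrank_alt1, Nat.choose_one_right])
    (by rw [Submodule.map_comp, map_coord1, map_shift1_alt1]) fun _ => diff_eq_zero_iff1
  rw [finrank_alt1_inf_ker N hN, Nat.choose_one_right, Nat.choose_one_right] at h
  omega

lemma finrank_cocycles_two :
    finrank (ZMod 2) (cocycles (basis (N + 1)) 2) = N + N / 2 := by
  have h := finrank_cocycles_add (q := 2) (diagShift ∘ₗ coord2 (N + 1)) shift2 (Alt2 N)
    (finrank_alt2 N) (by rw [Submodule.map_comp, map_coord2, map_diagShift_alt2])
    fun _ => diff_eq_zero_iff2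
  rw [← Ker2, finrank_ker2, Nat.choose_succ_succ' N 1, Nat.choose_one_right, one_add_one_eq_two] at h
  omega

lemma finrank_cocycles_three : finrank (ZMod 2) (cocycles (basis (N + 1)) 3) =
    N.choose 2 + finrank (ZMod 2) (Ker3 N) := by
  have h := finrank_cocycles_add (q := 3) (tail3 ∘ₗ coord3 (N + 1)) shift3 (Alt3 N)
    (finrank_alt3 N) (by rw [Submodule.map_comp, map_coord3, map_tail3_alt3])
    fun _ => diff_eq_zero_iff3
  rw [← Ker3, Nat.choose_succ_succ' N 2, two_add_one_eq_three] at h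
  omega

/-- Rank-nullity for `d` on `q`-forms replaces the coboundaries by the `q`-cocycles. -/
lemma betti_succ_add (q : ℕ) : betti (basis (N + 1)) (q + 1) + (N + 1).choose q =
    finrank (ZMod 2) (cocycles (basis (N + 1)) (q + 1)) +
      finrank (ZMod 2) (cocycles (basis (N + 1)) q) := by
  have hle : coboundaries (basis (N + 1)) (q + 1) ≤ cocycles (basis (N + 1)) (q + 1) := by
    rintro _ ⟨ω, hω, rfl⟩
    exact ⟨diff_mem_qForms hω, diff_diff ω⟩
  have : FiniteDimensional (ZMod 2) (cocycles (basis (N + 1)) (q + 1)) :=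
    Submodule.finiteDimensional_of_le (inf_le_left : _ ≤ qForms (M0 (N + 1)) (q + 1))
  have h1 := Submodule.finrank_quotient_add_finrank
    ((coboundaries (basis (N + 1)) (q + 1)).submoduleOf (cocycles (basis (N + 1)) (q + 1)))
  rw [(Submodule.submoduleOfEquivOfLe hle).finrank_eq] at h1
  have h2 := finrank_inf_ker_add_finrank_map (qForms (M0 (N + 1)) q) (diff N)
  rw [finrank_qForms] at h2
  change finrank (ZMod 2) (cocycles (basis (N + 1)) q) +
    finrank (ZMod 2) (coboundaries (basis (N + 1)) (q + 1)) = _ at h2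
  change betti (basis (N + 1)) (q + 1) + _ = _ at h1
  omega

lemma betti_one (hN : 0 < N) : betti (basis (N + 1)) 1 = 2 := by
  have h := betti_succ_add (N := N) 0
  rw [finrank_cocycles_zero, zero_add, finrank_cocycles_one hN, Nat.choose_zero_right] at h
  omega

lemma betti_two (hN : 0 < N) : betti (basis (N + 1)) 2 = N / 2 + 1 := by
  have h := betti_succ_add (N := N) 1
  rw [finrank_cocycles_one hN, Nat.choose_one_right] at h
  change betti (basis (N + 1)) 2 + _ = finrank _ (cocycles (basis (N + 1)) 2) + _ at h
  rw [finrank_cocycles_two] at h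
  omega

lemma betti_three : betti (basis (N + 1)) 3 = finrank (ZMod 2) (Ker3 N) + N / 2 := by
  have h := betti_succ_add (N := N) 2
  rw [finrank_cocycles_two, Nat.choose_succ_succ' N 1, Nat.choose_one_right] at h
  change betti (basis (N + 1)) 3 + (N + N.choose 2) =
    finrank _ (cocycles (basis (N + 1)) 3) + _ at h
  rw [finrank_cocycles_three] at h
  omega

end M0

end LieCoh

end

theorem theorem1p2 (n : ℕ) (hn : 2 ≤ n) :
    LieCoh.betti (LieCoh.M0.basis n) 1 = 2 ∧
    LieCoh.betti (LieCoh.M0.basis n) 2 = (n + 1) / 2 ∧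
    ∀ p m : ℕ, n = 2 ^ p + m → 0 < m → m ≤ 2 ^ p →
      (LieCoh.betti (LieCoh.M0.basis n) 3 : ℚ) =
        1 / 3 * ((2 : ℚ) ^ p - 1) * ((2 : ℚ) ^ ((p : ℤ) - 1) - 1)
          + 1 / 2 * (m : ℚ) * ((m : ℚ) - 1) + (⌊((n : ℚ) - 1) / 2⌋ : ℚ) := by
  obtain ⟨N, rfl⟩ : ∃ N, n = N + 1 := ⟨n - 1, by omega⟩
  refine ⟨LieCoh.M0.betti_one (by omega), ?_, fun p m hpm _ hm => ?_⟩
  · rw [LieCoh.M0.betti_two (by omega)]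
    omega
  -- The ideal has dimension `N = n - 1`, which is exactly the range length in
  -- `sum_sub_two_pow_log`.
  · have hN : N = 2 ^ p - 1 + m := by
      have : 0 < 2 ^ p := by positivity
      omega
    have hsum := LieCoh.sum_sub_two_pow_log p m hm
    rw [← hN, ← LieCoh.finrank_ker3] at hsum
    have hsum' := congrArg (fun x : ℤ => (x : ℚ)) hsum
    push_cast at hsum'
    have hfloor : ⌊(((N + 1 : ℕ) : ℚ) - 1) / 2⌋ = ((N / 2 : ℕ) : ℤ) := by
      rw [show (((N + 1 : ℕ) : ℚ) - 1) / 2 = (N : ℚ) / (2 : ℕ) by push_cast; ring]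
      rw [Rat.floor_natCast_div_natCast]
      norm_cast
    rw [LieCoh.M0.betti_three, hfloor, zpow_sub₀ (by norm_num), zpow_natCast, zpow_one,
      Nat.cast_add, Int.cast_natCast]
    linear_combination hsum' / 6
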